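/- Let $\theta_1,\dots,\theta_4\in\mathbb R$ satisfy $\theta_1^2+\theta_3^2<1$ and $\theta_2^2+\theta_4^2<1$, and put $$\rho_1=\theta_1\theta_2+\theta_3\theta_4,\quad \rho_2=\theta_2^2+\theta_4^2,\quad \rho_3=\theta_1^2,\quad \rho_4=\theta_1\theta_2,\quad \rho_5=\theta_2^2 .$$ For $k=(k_1,\dots,k_\tau)\in\mathbb N_0^\tau$ let $\Sigma_{(k)}$ be the correlation matrix indexed by the positions of the vector $(N_t,Y_{t,1},\dots,Y_{t,k_t})_{t=1,\dots,\tau}$ with diagonal entries $1$ and off-diagonal entries: $\rho_1$ between a frequency $N_t$ and a severity $Y_{t,j}$ of the same year, $\rho_2$ between two severities of the same year, $\rho_3$ between frequencies of different years, $\rho_4$ between a frequency and a severity of different years, $\rho_5$ between severities of different years. Let $$\Sigma^*_{(k)}=\begin{pmatrix}1&\Omega_{(k)}\\ \Omega_{(k)}^{\mathrm T}&\Sigma_{(k)}\end{pmatrix},$$ where the row $\Omega_{(k)}$ has the entry $\theta_1$ at each frequency and $\theta_2$ at each severity. Let $C_{(k)}$ and $C^*_{(k)}$ be the Gaussian copulas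 with correlation matrices $\Sigma_{(k)}$ and $\Sigma^*_{(k)}$, and let $\Phi$ be the standard normal distribution function. For $t=1,\dots,\tau$ and $j\ge1$ let $F_t$ be a distribution function of a law on $\mathbb N_0$ and $G_{t,j}$ a distribution function of a law on $[0,\infty)$ that has a density. Let $R$ (the random effect), $N_t$ (frequencies, with values in $\mathbb N_0$) and $Y_{t,j}$ (severities) be random variables on a probability space that follow the factor Gaussian copula model: for all $k,n\in\mathbb N_0^\tau$, $r\in\mathbb R$ and $y_{t,j}\in\mathbb R$, $$\mathbb P\big(R\le r,\ N_t\le n_t,\ Y_{t,j}\le y_{t,j}\ (t\le\tau,\ j\le k_t)\big)=C^*_{(k)}\Big(\Phi(r),\big(F_t(n_t),G_{t,1}(y_{t,1}),\dots,G_{t,k_t}(y_{t,k_t})\big)_{t\le\tau}\Big).$$ Let $Z_t=(N_t,Y_{t,1},\dots,Y_{t,N_t})$ be the observation of year $t$, a vector of random length (reduced to $N_t=0$ if $N_t=0$), and let $Z_t(k_t)=(N_t,Y_{t,1},\dots,Y_{t,k_t})$. Densities are taken with respect to counting measure for $N_t$ and Lebesgue measure for the severities. Then: (i) $(Z_t(k_t))_{t\le\tau}$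 follows the Gaussian copula model: for all $k,n,y$, $$\mathbb P\big(N_t\le n_t,\ Y_{t,j}\le y_{t,j}\ (t\le\tau,\ j\le k_t)\big)=C_{(k)}\Big(\big(F_t(n_t),G_{t,1}(y_{t,1}),\dots,G_{t,k_t}(y_{t,k_t})\big)_{t\le\tau}\Big).$$ (ii) Each $Z_t$ has a conditional density $h_t^*(\cdot\mid r)$ given $R=r$, and the conditional density of $Z_{(\tau)}=(Z_1,\dots,Z_\tau)$ given $R=r$ is $$h^*(z_{(\tau)}\mid r)=\prod_{t=1}^{\tau}h_t^*(z_t\mid r);$$ so $Z_1,\dots,Z_\tau$ are conditionally independent given $R=r$. The same holds for $Z_1(k_1),\dots,Z_\tau(k_\tau)$, for every $k\in\mathbb N_0^\tau$. (iii) For every $t$ for which $F_t$ is not degenerate (not the distribution function of a point mass), $N_t$ is independent of $R$ if and only if $\theta_1=0$. (iv) For every $t$ and every $k\ge1$, the vector of severities $(Y_{t,1},\dots,Y_{t,k})$ is independent of $R$ if and only if $\theta_2=0$. -/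

import Mathlib

open MeasureTheory ProbabilityTheory
open scoped ENNReal

noncomputable section

/-- The distribution function `Φ` of the standard normal law. -/
def stdNormalCDF (x : ℝ) : ℝ := cdf (gaussianReal 0 1) x

/-- The Gaussian copula with correlation matrix `S`: the joint distribution function of
`(Φ(X i))ᵢ` where `X` is centred Gaussian with covariance matrix `S`. At `u` in the unit cube this is
`Φ_{0,S}(Φ⁻¹(u i))ᵢ`, with the usual conventions `Φ⁻¹(0) = -∞` and `Φ⁻¹(1) = ∞`. -/
def gaussianCopula {ι : Type*} [Fintype ι] [DecidableEq ι] (S : Matrix ι ι ℝ) (u : ι → ℝ) : ℝ :=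
  (multivariateGaussian (0 : EuclideanSpace ℝ ι) S).real {x | ∀ i, stdNormalCDF (x i) ≤ u i}

/-- Positions in the vector `(N₁, Y₁₁, …, Y₁ₖ₁, …, N_τ, Y_τ₁, …)`: the pair `(t, 0)` is the frequency
of year `t`, and `(t, j + 1)` is the `j`-th severity of year `t` (severities counted from `0`). -/
abbrev ClaimIndex {τ : ℕ} (k : Fin τ → ℕ) : Type := Σ t : Fin τ, Fin (k t + 1)

/-- The correlation matrix of frequencies and severities. -/
def claimCorr {τ : ℕ} (ρ₁ ρ₂ ρ₃ ρ₄ ρ₅ : ℝ) (k : Fin τ → ℕ) :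
    Matrix (ClaimIndex k) (ClaimIndex k) ℝ :=
  Matrix.of fun a b =>
    if a.1 = b.1 then
      if (a.2 : ℕ) = (b.2 : ℕ) then 1
      else if (a.2 : ℕ) ≠ 0 ∧ (b.2 : ℕ) ≠ 0 then ρ₂
      else ρ₁
    else
      if (a.2 : ℕ) = 0 ∧ (b.2 : ℕ) = 0 then ρ₃
      else if (a.2 : ℕ) ≠ 0 ∧ (b.2 : ℕ) ≠ 0 then ρ₅
      else ρ₄

/-- The row of correlations between the random effect and the claims. -/
def effectCorr {τ : ℕ} (θ₁ θ₂ : ℝ) (k : Fin τ → ℕ) : Matrix Unit (ClaimIndex k) ℝ :=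
  Matrix.of fun _ a => if (a.2 : ℕ) = 0 then θ₁ else θ₂

/-- The correlation matrix of the random effect, frequencies and severities. -/
def factorCorr {τ : ℕ} (ρ₁ ρ₂ ρ₃ ρ₄ ρ₅ θ₁ θ₂ : ℝ) (k : Fin τ → ℕ) :
    Matrix (Unit ⊕ ClaimIndex k) (Unit ⊕ ClaimIndex k) ℝ :=
  Matrix.fromBlocks 1 (effectCorr θ₁ θ₂ k) (effectCorr θ₁ θ₂ k).transpose
    (claimCorr ρ₁ ρ₂ ρ₃ ρ₄ ρ₅ k)

/-- The vector `(F_t(n_t), G_{t,1}(y_{t,1}), …, G_{t,k_t}(y_{t,k_t}))_t` of marginal distribution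
functions, where `f t` is the law of the frequency and `G t j` the law of a severity. -/
def marginalValues {τ : ℕ} (f : Fin τ → PMF ℕ) (G : Fin τ → ℕ → Measure ℝ) (k : Fin τ → ℕ)
    (n : Fin τ → ℕ) (y : (t : Fin τ) → Fin (k t) → ℝ) : ClaimIndex k → ℝ :=
  fun a => Fin.cases (motive := fun _ => ℝ) ((f a.1).toMeasure.real (Set.Iic (n a.1)))
    (fun j => cdf (G a.1 j) (y a.1 j)) a.2

/-- The claims follow the Gaussian copula model: for all numbers `k t` of severities, the joint
distribution function of `(N_t, Y_{t,1}, …, Y_{t,k_t})_t` is the Gaussian copula with correlation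
matrix `claimCorr` at the marginals. -/
def IsClaimCopulaModel {Ω : Type*} [MeasurableSpace Ω] (P : Measure Ω) {τ : ℕ}
    (ρ₁ ρ₂ ρ₃ ρ₄ ρ₅ : ℝ) (f : Fin τ → PMF ℕ) (G : Fin τ → ℕ → Measure ℝ)
    (N : Fin τ → Ω → ℕ) (Y : Fin τ → ℕ → Ω → ℝ) : Prop :=
  ∀ (k n : Fin τ → ℕ) (y : (t : Fin τ) → Fin (k t) → ℝ),
    P.real {ω | ∀ t, N t ω ≤ n t ∧ ∀ j : Fin (k t), Y t j ω ≤ y t j} =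
      gaussianCopula (claimCorr ρ₁ ρ₂ ρ₃ ρ₄ ρ₅ k) (marginalValues f G k n y)

/-- The random effect and the claims follow the factor Gaussian copula model: for all numbers `k t`
of severities, the joint distribution function of `R` and `(N_t, Y_{t,1}, …, Y_{t,k_t})_t` is the
Gaussian copula with correlation matrix `factorCorr` at `Φ` and the marginals. -/
def IsFactorCopulaModel {Ω : Type*} [MeasurableSpace Ω] (P : Measure Ω) {τ : ℕ}
    (ρ₁ ρ₂ ρ₃ ρ₄ ρ₅ θ₁ θ₂ : ℝ) (f : Fin τ → PMF ℕ) (G : Fin τ → ℕ → Measure ℝ)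
    (R : Ω → ℝ) (N : Fin τ → Ω → ℕ) (Y : Fin τ → ℕ → Ω → ℝ) : Prop :=
  ∀ (k n : Fin τ → ℕ) (y : (t : Fin τ) → Fin (k t) → ℝ) (r : ℝ),
    P.real {ω | R ω ≤ r ∧ ∀ t, N t ω ≤ n t ∧ ∀ j : Fin (k t), Y t j ω ≤ y t j} =
      gaussianCopula (factorCorr ρ₁ ρ₂ ρ₃ ρ₄ ρ₅ θ₁ θ₂ k)
        (Sum.elim (fun _ => stdNormalCDF r) (marginalValues f G k n y))

/-- The observation `(N, Y₁, …, Y_N)` of one year, a vector of random length. -/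
def yearObs {Ω : Type*} (N : Ω → ℕ) (Y : ℕ → Ω → ℝ) (ω : Ω) : Σ n : ℕ, (Fin n → ℝ) :=
  ⟨N ω, fun j => Y j ω⟩

/-- The reference measure for densities of `(N, Y₁, …, Y_N)`: Lebesgue measure on `ℝⁿ` on each piece
`{n} × ℝⁿ` (for `n = 0`, a unit point mass). -/
def yearObsMeasure : Measure (Σ n : ℕ, (Fin n → ℝ)) :=
  Measure.sum fun n : ℕ => (volume : Measure (Fin n → ℝ)).map (Sigma.mk n)

/-- The frequency and the first `k` severities `(N, Y₁, …, Y_k)` of one year, `k` fixed. -/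
def yearVec {Ω : Type*} (k : ℕ) (N : Ω → ℕ) (Y : ℕ → Ω → ℝ) (ω : Ω) : ℕ × (Fin k → ℝ) :=
  (N ω, fun j => Y j ω)

/-- The reference measure for densities of `(N, Y₁, …, Y_k)`. -/
def yearVecMeasure (k : ℕ) : Measure (ℕ × (Fin k → ℝ)) := Measure.count.prod volume

/-- `h z r` is a conditional density, with respect to `ν`, of `Z` at `z` conditional on `R = r`. -/
structure IsCondDensity {Ω E : Type*} [MeasurableSpace Ω] [MeasurableSpace E] (P : Measure Ω)
    (R : Ω → ℝ) (Z : Ω → E) (ν : Measure E) (h : E → ℝ → ℝ≥0∞) : Prop where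
  measurable : Measurable (Function.uncurry h)
  lintegral_eq_one : ∀ r, ∫⁻ z, h z r ∂ν = 1
  joint : ∀ (A : Set ℝ) (B : Set E), MeasurableSet A → MeasurableSet B →
    P (R ⁻¹' A ∩ Z ⁻¹' B) = ∫⁻ r in A, (∫⁻ z in B, h z r ∂ν) ∂(P.map R)

/-- Each `Z t` has a conditional density given `R = r`, and the joint conditional density of the
family `(Z t)ₜ` given `R = r` is the product of the conditional densities of the `Z t`. -/
def CondDensityFactorizes {Ω ι : Type*} [Fintype ι] {E : ι → Type*} [MeasurableSpace Ω]
    [∀ t, MeasurableSpace (E t)] (P : Measure Ω) (R : Ω → ℝ) (Z : (t : ι) → Ω → E t)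
    (ν : (t : ι) → Measure (E t)) : Prop :=
  (∃ h : (t : ι) → E t → ℝ → ℝ≥0∞, ∀ t, IsCondDensity P R (Z t) (ν t) (h t)) ∧
  ∀ h : (t : ι) → E t → ℝ → ℝ≥0∞, (∀ t, IsCondDensity P R (Z t) (ν t) (h t)) →
    IsCondDensity P R (fun ω t => Z t ω) (Measure.pi ν) (fun z r => ∏ t, h t (z t) r)

end

/-! The prescribed correlations are those of a linear factor model. Take independent standard normal
variables: the effect `R`, one factor `M_t` per year, and one error `ε_{t,i}` per claim. The scores
`a_i R + b_i M_t + s_i ε_{t,i}`, with `(a, b) = (θ₁, θ₃)` for frequencies and `(θ₂, θ₄)` for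
severities, and `s_i² = 1 - a_i² - b_i² > 0`, have exactly these correlations
(`factorLoading_mul_transpose`). Applying quantile transforms to the scores gives a canonical factor
copula model. The finite-dimensional distribution functions determine the law of the effect and all
claims (`IsFactorCopulaModel.map_eq`), so every model has the canonical law and all assertions can
be checked there.

Claim (i) is read off from the claim scores alone. For (ii), given `R = r` the years are functions
of independent noises, so conditional probabilities of rectangles are products; conditional
densities exist because the errors enter with `s_i ≠ 0`
(`map_effect_severities_absolutelyContinuous`), and `condDensityFactorizes_of_map_eq` combines the
two facts. For (iii) and (iv), a zero loading removes `R` from the score, while a nonzero loading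
makes the conditional probability that the score is at most `c` strictly monotone in `r`, which
contradicts independence (`coeff_eq_zero_of_ae_eq_const`). -/

/-! ### Densities on finite product spaces. -/

theorem lintegral_pi_prod {n : ℕ} {E : Fin n → Type*} [∀ i, MeasurableSpace (E i)]
    (ν : (i : Fin n) → Measure (E i)) [∀ i, SigmaFinite (ν i)] (f : (i : Fin n) → E i → ℝ≥0∞)
    (hf : ∀ i, Measurable (f i)) :
    ∫⁻ x, ∏ i, f i (x i) ∂Measure.pi ν = ∏ i, ∫⁻ x, f i x ∂ν i := by
  induction n with
  | zero => simp
  | succ n ih =>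
    have h := (measurePreserving_piFinSuccAbove ν 0).symm
    rw [← h.lintegral_comp_emb (MeasurableEquiv.measurableEmbedding _)]
    rw [Fin.prod_univ_succ, ← ih (fun i => ν i.succ) (fun i => f i.succ) fun i => hf i.succ,
      ← lintegral_prod_mul (hf 0).aemeasurable (Finset.measurable_prod _ fun i _ =>
        (hf i.succ).comp (measurable_pi_apply i)).aemeasurable]
    refine lintegral_congr fun p => ?_
    rw [Fin.prod_univ_succ]
    rfl

theorem setLIntegral_pi_prod {n : ℕ} {E : Fin n → Type*} [∀ i, MeasurableSpace (E i)]
    (ν : (i : Fin n) → Measure (E i)) [∀ i, SigmaFinite (ν i)] (f : (i : Fin n) → E i → ℝ≥0∞)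
    (hf : ∀ i, Measurable (f i)) (B : (i : Fin n) → Set (E i)) :
    ∫⁻ x in Set.univ.pi B, ∏ i, f i (x i) ∂Measure.pi ν = ∏ i, ∫⁻ x in B i, f i x ∂ν i := by
  rw [Measure.restrict_pi_pi]
  exact lintegral_pi_prod _ f hf

theorem pi_absolutelyContinuous {n : ℕ} {E : Fin n → Type*} [∀ i, MeasurableSpace (E i)]
    (μ ν : (i : Fin n) → Measure (E i)) [∀ i, SigmaFinite (μ i)] [∀ i, SigmaFinite (ν i)]
    (h : ∀ i, (μ i).AbsolutelyContinuous (ν i)) :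
    (Measure.pi μ).AbsolutelyContinuous (Measure.pi ν) := by
  have : Measure.pi μ =
      (Measure.pi ν).withDensity fun x => ∏ i, (μ i).rnDeriv (ν i) (x i) := by
    refine Measure.pi_eq fun s hs => ?_
    rw [withDensity_apply _ (MeasurableSet.univ_pi hs),
      setLIntegral_pi_prod ν _ fun i => Measure.measurable_rnDeriv _ _]
    exact Finset.prod_congr rfl fun i _ => Measure.setLIntegral_rnDeriv (h i) _
  rw [this]
  exact withDensity_absolutelyContinuous _ _

/-! ### Conditional densities and their factorization. -/

section CondDensity

variable {Ω : Type*} [MeasurableSpace Ω] {P : Measure Ω} {R : Ω → ℝ}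

/-- The Radon–Nikodym derivative of the joint law with respect to the product measure serves as `h`.
Its sections integrate to one only for almost every `r`, so it is corrected on a null set of `r`. -/
theorem exists_isCondDensity [IsProbabilityMeasure P] {E : Type*} [MeasurableSpace E] {Z : Ω → E}
    {ν : Measure E} [SigmaFinite ν] (hR : Measurable R) (hZ : Measurable Z)
    (hac : (P.map fun ω => (R ω, Z ω)).AbsolutelyContinuous ((P.map R).prod ν)) :
    ∃ h : E → ℝ → ℝ≥0∞, IsCondDensity P R Z ν h := by
  have : IsProbabilityMeasure (P.map R) := Measure.isProbabilityMeasure_map hR.aemeasurable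
  set g : ℝ × E → ℝ≥0∞ := (P.map fun ω => (R ω, Z ω)).rnDeriv ((P.map R).prod ν)
  have hg : Measurable g := Measure.measurable_rnDeriv _ _
  have joint (A : Set ℝ) (B : Set E) (hA : MeasurableSet A) (hB : MeasurableSet B) :
      P (R ⁻¹' A ∩ Z ⁻¹' B) = ∫⁻ r in A, (∫⁻ z in B, g (r, z) ∂ν) ∂(P.map R) := by
    rw [← setLIntegral_prod _ hg.aemeasurable, Measure.setLIntegral_rnDeriv hac,
      Measure.map_apply (hR.prodMk hZ) (hA.prod hB)]
    rfl
  have hm : Measurable fun r => ∫⁻ z, g (r, z) ∂ν := hg.lintegral_prod_right'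
  have hone : (fun r => ∫⁻ z, g (r, z) ∂ν) =ᵐ[P.map R] fun _ => 1 := by
    refine ae_eq_of_forall_setLIntegral_eq_of_sigmaFinite hm measurable_const fun A hA _ => ?_
    have := joint A Set.univ hA .univ
    simp only [Measure.restrict_univ, Set.preimage_univ, Set.inter_univ] at this
    rw [← this, setLIntegral_one, Measure.map_apply hR hA]
  -- A good section, used in place of every section whose integral is not one.
  obtain ⟨r₀, hr₀⟩ := hone.exists
  have hS : MeasurableSet {r | ∫⁻ z, g (r, z) ∂ν = 1} := hm (measurableSet_singleton 1)
  classical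
  let h : E → ℝ → ℝ≥0∞ := fun z r =>
    if r ∈ {r | ∫⁻ z, g (r, z) ∂ν = 1} then g (r, z) else g (r₀, z)
  refine ⟨h, ?_, fun r => ?_, fun A B hA hB => ?_⟩
  · exact Measurable.ite (measurable_snd hS) (hg.comp measurable_swap)
      (hg.comp (measurable_const.prodMk measurable_fst))
  · by_cases hr : ∫⁻ z, g (r, z) ∂ν = 1
    · simp [h, hr]
    · simpa [h, hr] using hr₀
  · rw [joint A B hA hB]
    refine lintegral_congr_ae (ae_restrict_of_ae ?_)
    filter_upwards [hone] with r hr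
    have : r ∈ {r | ∫⁻ z, g (r, z) ∂ν = 1} := hr
    simp only [h, if_pos this]

variable {n : ℕ} {E : Fin n → Type*} [∀ t, MeasurableSpace (E t)]
  {S : Fin n → Type*} [∀ t, MeasurableSpace (S t)] {μ : (t : Fin n) → Measure (S t)}
  [∀ t, IsProbabilityMeasure (μ t)]

/-- The hypothesis `hlaw` says that, in law, `Z t` is a function of `R` and a noise of its own, with
all noises independent of each other and of `R`. Fubini in `r` then leaves a product measure of a
rectangle. -/
theorem measure_inter_eq_of_map_eq (hR : Measurable R) {Z : (t : Fin n) → Ω → E t}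
    (hZ : ∀ t, Measurable (Z t)) {z : (t : Fin n) → ℝ × S t → E t} (hz : ∀ t, Measurable (z t))
    (hlaw : P.map (fun ω => (R ω, fun t => Z t ω)) =
      ((P.map R).prod (Measure.pi μ)).map fun p => (p.1, fun t => z t (p.1, p.2 t)))
    {A : Set ℝ} (hA : MeasurableSet A) {B : (t : Fin n) → Set (E t)}
    (hB : ∀ t, MeasurableSet (B t)) :
    P (R ⁻¹' A ∩ (fun ω t => Z t ω) ⁻¹' Set.univ.pi B) =
      ∫⁻ r in A, ∏ t, μ t {s | z t (r, s) ∈ B t} ∂(P.map R) := by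
  have hm : Measurable fun p : ℝ × ((t : Fin n) → S t) => (p.1, fun t => z t (p.1, p.2 t)) := by
    refine measurable_fst.prodMk (measurable_pi_lambda _ fun t => (hz t).comp ?_)
    exact measurable_fst.prodMk ((measurable_pi_apply t).comp measurable_snd)
  have hAB : MeasurableSet (A ×ˢ Set.univ.pi B) := hA.prod (MeasurableSet.univ_pi hB)
  have h1 : P (R ⁻¹' A ∩ (fun ω t => Z t ω) ⁻¹' Set.univ.pi B) =
      P.map (fun ω => (R ω, fun t => Z t ω)) (A ×ˢ Set.univ.pi B) := by
    rw [Measure.map_apply (hR.prodMk (measurable_pi_lambda _ hZ)) hAB]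
    rfl
  rw [h1, hlaw, Measure.map_apply hm hAB, Measure.prod_apply (hm hAB), ← lintegral_indicator hA]
  refine lintegral_congr fun r => ?_
  by_cases hr : r ∈ A
  · rw [Set.indicator_of_mem hr, ← Measure.pi_pi]
    congr 1
    ext x
    simp [hr]
  · rw [Set.indicator_of_notMem hr, ← nonpos_iff_eq_zero]
    refine (measure_mono fun x hx => hr hx.1).trans (measure_empty (μ := Measure.pi μ)).le

/-- Any conditional density of `Z t` must agree, for almost every `r`, with the noise probability of
each fixed set. The product formula therefore holds on rectangles, and a π-system argument extends
it to all measurable sets. -/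
theorem condDensityFactorizes_of_map_eq [IsProbabilityMeasure P] (hR : Measurable R)
    {Z : (t : Fin n) → Ω → E t} (hZ : ∀ t, Measurable (Z t))
    {ν : (t : Fin n) → Measure (E t)} [∀ t, SigmaFinite (ν t)]
    {z : (t : Fin n) → ℝ × S t → E t} (hz : ∀ t, Measurable (z t))
    (hlaw : P.map (fun ω => (R ω, fun t => Z t ω)) =
      ((P.map R).prod (Measure.pi μ)).map fun p => (p.1, fun t => z t (p.1, p.2 t)))
    (hac : ∀ t, (P.map fun ω => (R ω, Z t ω)).AbsolutelyContinuous ((P.map R).prod (ν t))) :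
    CondDensityFactorizes P R Z ν := by
  have : IsProbabilityMeasure (P.map R) := Measure.isProbabilityMeasure_map hR.aemeasurable
  refine ⟨?_, fun h hh => ?_⟩
  · choose h hh using fun t => exists_isCondDensity hR (hZ t) (hac t)
    exact ⟨h, hh⟩
  have hmeas (r : ℝ) (t : Fin n) : Measurable fun x => h t x r :=
    (hh t).measurable.comp (measurable_id.prodMk measurable_const)
  have hprod : Measurable fun p : ((t : Fin n) → E t) × ℝ => ∏ t, h t (p.1 t) p.2 :=
    Finset.measurable_prod _ fun t _ => (hh t).measurable.comp
      (((measurable_pi_apply t).comp measurable_fst).prodMk measurable_snd)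
  have key (t : Fin n) (B : Set (E t)) (hB : MeasurableSet B) :
      (fun r => μ t {s | z t (r, s) ∈ B}) =ᵐ[P.map R] fun r => ∫⁻ x in B, h t x r ∂ν t := by
    refine ae_eq_of_forall_setLIntegral_eq_of_sigmaFinite
      (measurable_measure_prodMk_left (hz t hB))
      (((hh t).measurable.comp measurable_swap).lintegral_prod_right') fun A hA _ => ?_
    rw [← (hh t).joint A B hA hB]
    classical
    -- A rectangle constraining only coordinate `t`, so that all other factors are one.
    let B' : (i : Fin n) → Set (E i) := Function.update (fun _ => Set.univ) t B
    have hB' : ∀ i, MeasurableSet (B' i) := fun i => by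
      rcases eq_or_ne i t with rfl | hi
      · simpa [B'] using hB
      · simp [B', hi]
    have e := measure_inter_eq_of_map_eq hR hZ hz hlaw hA hB'
    have e1 : (fun ω t => Z t ω) ⁻¹' Set.univ.pi B' = Z t ⁻¹' B := by
      ext ω
      simp only [Set.mem_preimage, Set.mem_univ_pi]
      refine ⟨fun H => by simpa [B'] using H t, fun H i => ?_⟩
      rcases eq_or_ne i t with rfl | hi
      · simpa [B'] using H
      · simp [B', hi]
    rw [e1] at e
    rw [e]
    refine lintegral_congr fun r => ?_
    rw [Finset.prod_eq_single t]
    · simp [B']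
    · intro i _ hi
      simp [B', hi]
    · simp
  refine ⟨hprod, fun r => ?_, fun A B hA hB => ?_⟩
  · rw [lintegral_pi_prod ν (fun t x => h t x r) (hmeas r)]
    simp [(hh _).lintegral_eq_one r]
  have hZm : Measurable fun ω t => Z t ω := measurable_pi_lambda _ hZ
  -- For fixed `A`, by Tonelli, the assertion becomes an equality of finite measures in `B`, one of
  -- them with density `D`.
  set D : ((t : Fin n) → E t) → ℝ≥0∞ := fun x => ∫⁻ r in A, ∏ t, h t (x t) r ∂(P.map R)
  have hD : Measurable D := hprod.lintegral_prod_right'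
  have swap (B : Set ((t : Fin n) → E t)) :
      ∫⁻ r in A, (∫⁻ x in B, ∏ t, h t (x t) r ∂Measure.pi ν) ∂(P.map R) =
        ∫⁻ x in B, D x ∂Measure.pi ν :=
    lintegral_lintegral_swap (hprod.comp measurable_swap).aemeasurable
  have eq : (P.restrict (R ⁻¹' A)).map (fun ω t => Z t ω) = (Measure.pi ν).withDensity D := by
    refine ext_of_generate_finite _ generateFrom_pi.symm isPiSystem_pi ?_ ?_
    · rintro _ ⟨B, hB, rfl⟩
      have hB : ∀ t, MeasurableSet (B t) := fun t => hB t trivial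
      have hBm := MeasurableSet.univ_pi hB
      rw [Measure.map_apply hZm hBm, Measure.restrict_apply (hZm hBm), Set.inter_comm,
        measure_inter_eq_of_map_eq hR hZ hz hlaw hA hB, withDensity_apply _ hBm, ← swap]
      refine lintegral_congr_ae (ae_restrict_of_ae ?_)
      filter_upwards [ae_all_iff.2 fun t => key t (B t) (hB t)] with r hr
      rw [setLIntegral_pi_prod ν (fun t x => h t x r) (hmeas r)]
      exact Finset.prod_congr rfl fun t _ => hr t
    · rw [Measure.map_apply hZm .univ, withDensity_apply _ .univ, ← swap, Measure.restrict_univ]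
      simp_rw [lintegral_pi_prod ν (fun t x => h t x _) (hmeas _), (hh _).lintegral_eq_one]
      simp [Measure.map_apply hR hA]
  have := congrArg (fun m => m B) eq
  rw [Measure.map_apply hZm hB, Measure.restrict_apply (hZm hB), withDensity_apply _ hB,
    ← swap, Set.inter_comm] at this
  exact this

end CondDensity

/-! ### Laws on real product spaces determined by distribution functions. -/

theorem measure_pi_real_ext {L κ : Type*} {μ ν : Measure (L → ℝ)} [IsProbabilityMeasure μ]
    [IsProbabilityMeasure ν] (T : κ → Finset L) (hT : ∀ s : Finset L, ∃ k, s ⊆ T k)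
    (h : ∀ k (c : L → ℝ), μ {x | ∀ i ∈ T k, x i ≤ c i} = ν {x | ∀ i ∈ T k, x i ≤ c i}) :
    μ = ν := by
  classical
  have h' (s : Finset L) (c : L → ℝ) :
      μ {x | ∀ i ∈ s, x i ≤ c i} = ν {x | ∀ i ∈ s, x i ≤ c i} := by
    obtain ⟨k, hk⟩ := hT s
    -- The superfluous coordinates of `T k` are released by sending their bounds to infinity.
    let c' (m : ℕ) (i : L) : ℝ := if i ∈ s then c i else m
    let A (m : ℕ) : Set (L → ℝ) := {x | ∀ i ∈ T k, x i ≤ c' m i}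
    have hA : {x : L → ℝ | ∀ i ∈ s, x i ≤ c i} = ⋃ m, A m := by
      ext x
      simp only [Set.mem_ofPred_eq, Set.mem_iUnion, A, c']
      constructor
      · intro hx
        obtain ⟨m, hm⟩ := exists_nat_ge (∑ i ∈ T k, |x i|)
        refine ⟨m, fun i hi => ?_⟩
        split_ifs with his
        · exact hx i his
        · exact (le_abs_self _).trans
            ((Finset.single_le_sum (fun j _ => abs_nonneg (x j)) hi).trans hm)
      · rintro ⟨m, hm⟩ i hi
        simpa [hi] using hm i (hk hi)
    have hmono : Monotone A := fun m m' hmm x hx i hi => (hx i hi).trans <| by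
      simp only [c']
      split_ifs
      · exact le_rfl
      · exact_mod_cast hmm
    rw [hA, hmono.measure_iUnion, hmono.measure_iUnion]
    exact iSup_congr fun m => h k (c' m)
  let π (i : L) : Set (Set (L → ℝ)) := Set.preimage (Function.eval i) '' Set.range Set.Iic
  have hπ (i : L) : IsPiSystem (π i) := by
    rintro _ ⟨_, ⟨a, rfl⟩, rfl⟩ _ ⟨_, ⟨b, rfl⟩, rfl⟩ _
    exact ⟨_, ⟨min a b, rfl⟩, by ext; simp⟩
  refine ext_of_generate_finite (piiUnionInter π Set.univ) ?_
    (isPiSystem_piiUnionInter π hπ Set.univ) ?_ (by simp)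
  · apply le_antisymm
    · refine iSup_le fun i => ?_
      rw [BorelSpace.measurable_eq (α := ℝ), borel_eq_generateFrom_Iic,
        MeasurableSpace.comap_generateFrom]
      exact MeasurableSpace.generateFrom_mono
        (subset_piiUnionInter (π := π) (Set.mem_univ i))
    · refine MeasurableSpace.generateFrom_le ?_
      rintro _ ⟨t, _, F, hF, rfl⟩
      refine Finset.measurableSet_biInter t fun i hi => ?_
      obtain ⟨_, ⟨a, rfl⟩, h⟩ := hF i hi
      rw [← h]
      exact measurable_pi_apply i measurableSet_Iic
  · rintro _ ⟨t, _, F, hF, rfl⟩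
    choose! c hc using fun i (hi : i ∈ t) => show ∃ c, Function.eval i ⁻¹' Set.Iic c = F i by
      obtain ⟨_, ⟨a, rfl⟩, h⟩ := hF i hi
      exact ⟨a, h⟩
    have : (⋂ i ∈ t, F i) = {x | ∀ i ∈ t, x i ≤ c i} := by
      ext x
      simp only [Set.mem_iInter, Set.mem_ofPred_eq]
      refine forall₂_congr fun i hi => ?_
      rw [← hc i hi]
      rfl
    rw [this, h']

/-! ### Quantile transforms of a standard normal variable. -/

section Quantile

instance : (gaussianReal 0 1).IsOpenPosMeasure :=
  (gaussianReal_absolutelyContinuous' 0 one_ne_zero).isOpenPosMeasure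

theorem stdNormalCDF_eq (x : ℝ) : stdNormalCDF x = (gaussianReal 0 1).real (Set.Iic x) :=
  cdf_eq_real _ x

theorem monotone_stdNormalCDF : Monotone stdNormalCDF := monotone_cdf _

theorem stdNormalCDF_pos (x : ℝ) : 0 < stdNormalCDF x := by
  rw [stdNormalCDF_eq, measureReal_def, ENNReal.toReal_pos_iff]
  exact ⟨((isOpen_Iio.measure_pos _ (Set.nonempty_Iio (a := x))).trans_le
    (measure_mono Set.Iio_subset_Iic_self)), measure_lt_top _ _⟩

theorem stdNormalCDF_lt_one (x : ℝ) : stdNormalCDF x < 1 := by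
  have h := probReal_add_probReal_compl (μ := gaussianReal 0 1) (measurableSet_Iic (a := x))
  have : 0 < (gaussianReal 0 1).real (Set.Iic x)ᶜ := by
    rw [Set.compl_Iic, measureReal_def, ENNReal.toReal_pos_iff]
    exact ⟨isOpen_Ioi.measure_pos _ Set.nonempty_Ioi, measure_lt_top _ _⟩
  rw [stdNormalCDF_eq]
  linarith

theorem stdNormalCDF_strictMono : StrictMono stdNormalCDF := fun x y hxy => by
  have h := measureReal_union (μ := gaussianReal 0 1) (s₁ := Set.Iic x) (s₂ := Set.Ioc x y)
    (Set.Iic_disjoint_Ioc le_rfl) measurableSet_Ioc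
  rw [Set.Iic_union_Ioc_eq_Iic hxy.le] at h
  have : 0 < (gaussianReal 0 1).real (Set.Ioc x y) := by
    rw [measureReal_def, ENNReal.toReal_pos_iff]
    exact ⟨(isOpen_Ioo.measure_pos _ (Set.nonempty_Ioo.2 hxy)).trans_le
      (measure_mono Set.Ioo_subset_Ioc_self), measure_lt_top _ _⟩
  rw [stdNormalCDF_eq, stdNormalCDF_eq]
  linarith

/-- The quantile transform taking a standard normal variable to one with law `G`. -/
noncomputable def quantileTransform (G : Measure ℝ) (x : ℝ) : ℝ :=
  sInf {y | stdNormalCDF x ≤ cdf G y}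

/-- Since `0 < Φ(x) < 1`, the set in the infimum is nonempty and bounded below; right continuity of
the distribution function puts its infimum in the set. -/
theorem quantileTransform_le_iff (G : Measure ℝ) (x y : ℝ) :
    quantileTransform G x ≤ y ↔ stdNormalCDF x ≤ cdf G y := by
  have hne : {y | stdNormalCDF x ≤ cdf G y}.Nonempty :=
    (((tendsto_cdf_atTop G).eventually (lt_mem_nhds (stdNormalCDF_lt_one x))).exists).imp
      fun _ h => le_of_lt h
  obtain ⟨b, hb⟩ := ((tendsto_cdf_atBot G).eventually (gt_mem_nhds (stdNormalCDF_pos x))).exists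
  have hbdd : BddBelow {y | stdNormalCDF x ≤ cdf G y} := ⟨b, fun y hy => by
    by_contra! hlt
    exact absurd (hy.trans (monotone_cdf G hlt.le)) (not_le.2 hb)⟩
  refine ⟨fun h => ?_, fun h => csInf_le hbdd h⟩
  have hright : ∀ z, y < z → stdNormalCDF x ≤ cdf G z := fun z hz => by
    obtain ⟨w, hw, hwz⟩ := (csInf_lt_iff hbdd hne).1 (h.trans_lt hz)
    exact le_trans hw (monotone_cdf G hwz.le)
  have hc := ((cdf G).right_continuous y).mono_left (nhdsWithin_mono y Set.Ioi_subset_Ici_self)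
  exact ge_of_tendsto hc (eventually_nhdsWithin_of_forall fun z hz => hright z hz)

theorem measurable_quantileTransform (G : Measure ℝ) : Measurable (quantileTransform G) :=
  measurable_of_Iic fun y => by
    have : quantileTransform G ⁻¹' Set.Iic y = {x | stdNormalCDF x ≤ cdf G y} := by
      ext x
      exact quantileTransform_le_iff G x y
    rw [this]
    exact measurableSet_le monotone_stdNormalCDF.measurable measurable_const

/-- The quantile transform taking a standard normal variable to one with law `f`. -/
noncomputable def natQuantileTransform (f : PMF ℕ) (x : ℝ) : ℕ :=
  sInf {n | stdNormalCDF x ≤ f.toMeasure.real (Set.Iic n)}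

theorem natQuantileTransform_le_iff (f : PMF ℕ) (x : ℝ) (n : ℕ) :
    natQuantileTransform f x ≤ n ↔ stdNormalCDF x ≤ f.toMeasure.real (Set.Iic n) := by
  have htend : Filter.Tendsto (fun n => f.toMeasure.real (Set.Iic n)) Filter.atTop (nhds 1) := by
    have h := tendsto_measure_iUnion_atTop (μ := f.toMeasure)
      (fun a b hab => Set.Iic_subset_Iic.2 hab : Monotone (Set.Iic : ℕ → Set ℕ))
    rw [Set.iUnion_Iic, measure_univ] at h
    exact (ENNReal.tendsto_toReal ENNReal.one_ne_top).comp h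
  have hne : {n | stdNormalCDF x ≤ f.toMeasure.real (Set.Iic n)}.Nonempty :=
    ((htend.eventually (lt_mem_nhds (stdNormalCDF_lt_one x))).exists).imp fun _ h => le_of_lt h
  refine ⟨fun h => ?_, fun h => Nat.sInf_le h⟩
  exact le_trans (Nat.sInf_mem hne) (measureReal_mono (Set.Iic_subset_Iic.2 h))

theorem measurable_natQuantileTransform (f : PMF ℕ) : Measurable (natQuantileTransform f) :=
  measurable_of_Iic fun n => by
    have : natQuantileTransform f ⁻¹' Set.Iic n =
        {x | stdNormalCDF x ≤ f.toMeasure.real (Set.Iic n)} := by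
      ext x
      exact natQuantileTransform_le_iff f x n
    rw [this]
    exact measurableSet_le monotone_stdNormalCDF.measurable measurable_const

end Quantile

/-! ### Gaussian copulas from linear images of independent normals. -/

section Gaussian

/-- Both characteristic functions at `t` equal `exp(-‖Aᵀ t‖² / 2)`. -/
theorem map_mulVec_pi_gaussianReal {ι κ : Type*} [Fintype ι] [Fintype κ] [DecidableEq ι]
    (A : Matrix ι κ ℝ) :
    (Measure.pi fun _ : κ => gaussianReal 0 1).map (fun x => WithLp.toLp 2 (A.mulVec x)) =
      multivariateGaussian (0 : EuclideanSpace ℝ ι) (A * A.transpose) := by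
  have hm : Measurable fun x : κ → ℝ => A.mulVec x := by
    refine measurable_pi_lambda _ fun i => ?_
    simp only [Matrix.mulVec, dotProduct]
    fun_prop
  have hm' : Measurable fun x : κ → ℝ => WithLp.toLp 2 (A.mulVec x) := by fun_prop
  have hpsd : (A * A.transpose).PosSemidef := by
    simpa using Matrix.posSemidef_self_mul_conjTranspose A
  have := Measure.isProbabilityMeasure_map (μ := Measure.pi fun _ : κ => gaussianReal 0 1)
    hm'.aemeasurable
  apply Measure.ext_of_charFun
  ext t
  have h := charFun_stdGaussian
    (WithLp.toLp 2 (A.transpose.mulVec (WithLp.ofLp t)) : EuclideanSpace ℝ κ)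
  rw [charFun_apply, ← map_pi_eq_stdGaussian,
    integral_map (by fun_prop) (Measurable.aestronglyMeasurable (by fun_prop))] at h
  have hinner (x : κ → ℝ) : inner ℝ (WithLp.toLp 2 (A.mulVec x) : EuclideanSpace ℝ ι) t =
      inner ℝ (WithLp.toLp 2 x : EuclideanSpace ℝ κ)
        (WithLp.toLp 2 (A.transpose.mulVec (WithLp.ofLp t))) := by
    simp only [EuclideanSpace.inner_eq_star_dotProduct, star_trivial]
    rw [Matrix.mulVec_transpose, ← Matrix.dotProduct_mulVec]
  rw [charFun_multivariateGaussian hpsd, charFun_apply, integral_map hm'.aemeasurable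
    (Measurable.aestronglyMeasurable (by fun_prop))]
  simp_rw [hinner]
  rw [h]
  congr 1
  rw [← Complex.ofReal_pow, EuclideanSpace.real_norm_sq_eq, ← Matrix.mulVec_mulVec,
    Matrix.dotProduct_mulVec, ← Matrix.mulVec_transpose]
  simp [dotProduct, sq, neg_div]

theorem measurableSet_forall_stdNormalCDF_mulVec_le {ι κ : Type*} [Fintype ι] [Fintype κ]
    (A : Matrix ι κ ℝ) (u : ι → ℝ) :
    MeasurableSet {x | ∀ i, stdNormalCDF (A.mulVec x i) ≤ u i} := by
  rw [Set.ofPred_forall]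
  refine MeasurableSet.iInter fun i => measurableSet_le ?_ measurable_const
  refine monotone_stdNormalCDF.measurable.comp ?_
  simp only [Matrix.mulVec, dotProduct]
  fun_prop

theorem gaussianCopula_mul_transpose {ι κ : Type*} [Fintype ι] [Fintype κ] [DecidableEq ι]
    (A : Matrix ι κ ℝ) (u : ι → ℝ) :
    gaussianCopula (A * A.transpose) u =
      (Measure.pi fun _ : κ => gaussianReal 0 1).real
        {x | ∀ i, stdNormalCDF (A.mulVec x i) ≤ u i} := by
  have hm' : Measurable fun x : κ → ℝ => WithLp.toLp 2 (A.mulVec x) := by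
    refine (WithLp.measurable_toLp _ _).comp (measurable_pi_lambda _ fun i => ?_)
    simp only [Matrix.mulVec, dotProduct]
    fun_prop
  rw [gaussianCopula, ← map_mulVec_pi_gaussianReal, map_measureReal_apply hm']
  · rfl
  · rw [Set.ofPred_forall]
    refine MeasurableSet.iInter fun i => measurableSet_le ?_ measurable_const
    exact monotone_stdNormalCDF.measurable.comp (by fun_prop)

end Gaussian

/-! ### The factor model and its loading matrices. -/

/-- The sequence of coefficients with value `x` for the frequency and `y` for all severities. -/
def freqSevCoeff (x y : ℝ) (i : ℕ) : ℝ := if i = 0 then x else y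

/-- The law of the noise of one year: a factor shared by all claims of the year and a sequence of
idiosyncratic factors, all of them independent and standard normal. -/
noncomputable def yearNoise : Measure (ℝ × (ℕ → ℝ)) :=
  (gaussianReal 0 1).prod (Measure.infinitePi fun _ => gaussianReal 0 1)

instance : IsProbabilityMeasure yearNoise := by
  unfold yearNoise
  infer_instance

/-- The law of the random effect and the noise of all years. -/
noncomputable def factorNoise (τ : ℕ) : Measure (ℝ × (Fin τ → ℝ × (ℕ → ℝ))) :=
  (gaussianReal 0 1).prod (Measure.pi fun _ => yearNoise)

instance (τ : ℕ) : IsProbabilityMeasure (factorNoise τ) := by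
  unfold factorNoise
  infer_instance

/-- The normal score of the `i`-th claim of a year, linear in the random effect `p.1`, the factor
`p.2.1` of the year, and the idiosyncratic factor `p.2.2 i`. -/
def normalScore (a b s : ℕ → ℝ) (i : ℕ) (p : ℝ × ℝ × (ℕ → ℝ)) : ℝ :=
  a i * p.1 + b i * p.2.1 + s i * p.2.2 i

theorem measurable_normalScore (a b s : ℕ → ℝ) (i : ℕ) : Measurable (normalScore a b s i) := by
  unfold normalScore
  fun_prop

/-- The frequency and the severities of a year as functions of the random effect and the noise. -/
noncomputable def claimsOfNoise (a b s : ℕ → ℝ) (f : PMF ℕ) (G : ℕ → Measure ℝ)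
    (p : ℝ × ℝ × (ℕ → ℝ)) : ℕ × (ℕ → ℝ) :=
  (natQuantileTransform f (normalScore a b s 0 p),
    fun j => quantileTransform (G j) (normalScore a b s (j + 1) p))

theorem measurable_claimsOfNoise (a b s : ℕ → ℝ) (f : PMF ℕ) (G : ℕ → Measure ℝ) :
    Measurable (claimsOfNoise a b s f G) :=
  ((measurable_natQuantileTransform f).comp (measurable_normalScore a b s 0)).prodMk
    (measurable_pi_lambda _ fun j =>
      (measurable_quantileTransform (G j)).comp (measurable_normalScore a b s (j + 1)))

section Loading

variable {τ : ℕ} (k : Fin τ → ℕ)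

/-- The finitely many independent factors that enter the claims with index in `ClaimIndex k`. -/
def noiseVector (p : ℝ × (Fin τ → ℝ × (ℕ → ℝ))) : Unit ⊕ (Fin τ ⊕ ClaimIndex k) → ℝ :=
  Sum.elim (fun _ => p.1) (Sum.elim (fun t => (p.2 t).1) fun c => (p.2 c.1).2 c.2)

theorem measurable_noiseVector : Measurable (noiseVector k) := by
  refine measurable_pi_lambda _ fun i => ?_
  rcases i with _ | t | c <;> simp only [noiseVector, Sum.elim_inl, Sum.elim_inr] <;> fun_prop

theorem map_noiseVector :
    (factorNoise τ).map (noiseVector k) = Measure.pi fun _ => gaussianReal 0 1 := by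
  symm
  refine Measure.pi_eq fun B hB => ?_
  rw [Measure.map_apply (measurable_noiseVector k) (MeasurableSet.univ_pi hB)]
  classical
  let D (t : Fin τ) (i : ℕ) : Set ℝ :=
    if h : i < k t + 1 then B (.inr (.inr ⟨t, ⟨i, h⟩⟩)) else Set.univ
  have hD (t : Fin τ) (i : ℕ) : MeasurableSet (D t i) := by
    simp only [D]
    split_ifs
    exacts [hB _, .univ]
  have hset : noiseVector k ⁻¹' Set.univ.pi B =
      B (.inl ()) ×ˢ Set.univ.pi fun t =>
        B (.inr (.inl t)) ×ˢ ((Finset.range (k t + 1) : Finset ℕ) : Set ℕ).pi (D t) := by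
    ext p
    simp only [noiseVector, Set.mem_preimage, Sum.forall, Sum.elim_inl,
      Sum.elim_inr, Set.mem_prod, Set.mem_pi, Finset.coe_range, Set.mem_Iio, Sigma.forall,
      forall_and]
    simp only [Set.mem_univ, forall_const]
    refine and_congr ⟨fun H => H (), fun H _ => H⟩
      (and_congr Iff.rfl (forall_congr' fun t => ?_))
    refine ⟨fun H i hi => ?_, fun H i => ?_⟩
    · simpa only [D, dif_pos hi] using H ⟨i, hi⟩
    · simpa only [D, dif_pos i.2] using H i i.2
  rw [hset, factorNoise, Measure.prod_prod, Measure.pi_pi, Fintype.prod_sum_type,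
    Fintype.prod_sum_type]
  simp only [Finset.univ_unique, Finset.prod_singleton, yearNoise, Measure.prod_prod]
  rw [Finset.prod_mul_distrib, Fintype.prod_sigma]
  congr 2
  refine Finset.prod_congr rfl fun t _ => ?_
  rw [Measure.infinitePi_pi _ fun i _ => hD t i, Finset.prod_range]
  exact Finset.prod_congr rfl fun i _ => by simp only [D, dif_pos i.2]

/-- The matrix of the claim scores as linear functions of the factors. -/
def claimLoading (a b s : ℕ → ℝ) :
    Matrix (ClaimIndex k) (Unit ⊕ (Fin τ ⊕ ClaimIndex k)) ℝ :=
  Matrix.of fun c => Sum.elim (fun _ => a c.2)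
    (Sum.elim (fun t => if c.1 = t then b c.2 else 0) fun d => if c = d then s c.2 else 0)

/-- The matrix of the random effect and the claim scores as linear functions of the factors. -/
def factorLoading (a b s : ℕ → ℝ) :
    Matrix (Unit ⊕ ClaimIndex k) (Unit ⊕ (Fin τ ⊕ ClaimIndex k)) ℝ :=
  Matrix.of (Sum.elim (fun _ => Sum.elim (fun _ => 1) fun _ => 0) (claimLoading k a b s))

variable {k}

theorem factorLoading_inl_inl (a b s : ℕ → ℝ) (u v : Unit) :
    factorLoading k a b s (.inl u) (.inl v) = 1 := rfl

theorem factorLoading_inl_inr (a b s : ℕ → ℝ) (u : Unit) (v : Fin τ ⊕ ClaimIndex k) :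
    factorLoading k a b s (.inl u) (.inr v) = 0 := rfl

theorem factorLoading_inr (a b s : ℕ → ℝ) (c : ClaimIndex k) :
    factorLoading k a b s (.inr c) = claimLoading k a b s c := rfl

theorem claimLoading_inl (a b s : ℕ → ℝ) (c : ClaimIndex k) (u : Unit) :
    claimLoading k a b s c (.inl u) = a c.2 := rfl

theorem claimLoading_mulVec (a b s : ℕ → ℝ) (p : ℝ × (Fin τ → ℝ × (ℕ → ℝ))) (c : ClaimIndex k) :
    (claimLoading k a b s).mulVec (noiseVector k p) c =
      normalScore a b s c.2 (p.1, p.2 c.1) := by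
  simp [Matrix.mulVec, dotProduct, claimLoading, noiseVector, normalScore, Fintype.sum_sum_type,
    add_assoc]

theorem factorLoading_mulVec_inl (a b s : ℕ → ℝ) (p : ℝ × (Fin τ → ℝ × (ℕ → ℝ))) :
    (factorLoading k a b s).mulVec (noiseVector k p) (.inl ()) = p.1 := by
  simp [Matrix.mulVec, dotProduct, factorLoading_inl_inl, factorLoading_inl_inr, noiseVector]

/-- Claims of different years share only the effect, claims of one year also share its factor, and
the errors fill the variances up to one. -/
theorem claimLoading_mul_transpose {θ₁ θ₂ θ₃ θ₄ s₁ s₂ : ℝ} (h₁ : s₁ ^ 2 = 1 - θ₁ ^ 2 - θ₃ ^ 2)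
    (h₂ : s₂ ^ 2 = 1 - θ₂ ^ 2 - θ₄ ^ 2) :
    (claimLoading k (freqSevCoeff θ₁ θ₂) (freqSevCoeff θ₃ θ₄) (freqSevCoeff s₁ s₂)) *
      (claimLoading k (freqSevCoeff θ₁ θ₂) (freqSevCoeff θ₃ θ₄) (freqSevCoeff s₁ s₂)).transpose =
      claimCorr (θ₁ * θ₂ + θ₃ * θ₄) (θ₂ ^ 2 + θ₄ ^ 2) (θ₁ ^ 2) (θ₁ * θ₂) (θ₂ ^ 2) k := by
  ext ⟨t, i⟩ ⟨u, j⟩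
  simp only [Matrix.mul_apply, Matrix.transpose_apply, claimLoading, Matrix.of_apply,
    Fintype.sum_sum_type, Sum.elim_inl, Sum.elim_inr, Finset.univ_unique, Finset.sum_singleton,
    ite_mul, zero_mul, Finset.sum_ite_eq, Finset.mem_univ, if_true, claimCorr]
  by_cases htu : t = u
  · subst htu
    by_cases hij : i = j
    · subst hij
      by_cases hi : (i : ℕ) = 0
      · simp [freqSevCoeff, hi]
        linarith
      · simp [freqSevCoeff, hi]
        linarith
    · have hij' : (i : ℕ) ≠ j := fun h => hij (Fin.ext h)
      by_cases hi : (i : ℕ) = 0 <;> by_cases hj : (j : ℕ) = 0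
      · omega
      all_goals
        simp only [if_neg hij']
        simp [freqSevCoeff, hi, hj, Ne.symm hij]
        try ring
  · by_cases hi : (i : ℕ) = 0 <;> by_cases hj : (j : ℕ) = 0 <;>
      simp [freqSevCoeff, hi, hj, htu, Ne.symm htu, sq, mul_comm]

theorem factorLoading_mul_transpose {θ₁ θ₂ θ₃ θ₄ s₁ s₂ : ℝ} (h₁ : s₁ ^ 2 = 1 - θ₁ ^ 2 - θ₃ ^ 2)
    (h₂ : s₂ ^ 2 = 1 - θ₂ ^ 2 - θ₄ ^ 2) :
    (factorLoading k (freqSevCoeff θ₁ θ₂) (freqSevCoeff θ₃ θ₄) (freqSevCoeff s₁ s₂)) *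
      (factorLoading k (freqSevCoeff θ₁ θ₂) (freqSevCoeff θ₃ θ₄) (freqSevCoeff s₁ s₂)).transpose =
      factorCorr (θ₁ * θ₂ + θ₃ * θ₄) (θ₂ ^ 2 + θ₄ ^ 2) (θ₁ ^ 2) (θ₁ * θ₂) (θ₂ ^ 2) θ₁ θ₂ k := by
  ext (⟨⟩ | c) (⟨⟩ | d)
  · simp [Matrix.mul_apply, factorLoading_inl_inl, factorLoading_inl_inr, factorCorr]
  · simp [Matrix.mul_apply, factorLoading_inl_inl, factorLoading_inl_inr, factorLoading_inr,
      claimLoading_inl, factorCorr, effectCorr, freqSevCoeff]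
  · simp [Matrix.mul_apply, factorLoading_inl_inl, factorLoading_inl_inr, factorLoading_inr,
      claimLoading_inl, factorCorr, effectCorr, freqSevCoeff]
  · rw [factorCorr, Matrix.fromBlocks_apply₂₂, ← claimLoading_mul_transpose h₁ h₂]
    rfl

theorem forall_claimIndex_marginalValues_iff (a b s : ℕ → ℝ) (f : Fin τ → PMF ℕ)
    (G : Fin τ → ℕ → Measure ℝ) (n : Fin τ → ℕ) (y : (t : Fin τ) → Fin (k t) → ℝ)
    (p : ℝ × (Fin τ → ℝ × (ℕ → ℝ))) :
    (∀ c, stdNormalCDF ((claimLoading k a b s).mulVec (noiseVector k p) c) ≤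
        marginalValues f G k n y c) ↔
      ∀ t, (claimsOfNoise a b s (f t) (G t) (p.1, p.2 t)).1 ≤ n t ∧
        ∀ j : Fin (k t), (claimsOfNoise a b s (f t) (G t) (p.1, p.2 t)).2 j ≤ y t j := by
  simp only [claimLoading_mulVec, Sigma.forall, Fin.forall_fin_succ, claimsOfNoise,
    natQuantileTransform_le_iff, quantileTransform_le_iff, marginalValues, Fin.cases_zero,
    Fin.cases_succ, Fin.val_zero, Fin.val_succ]

end Loading

/-! ### The canonical model has the prescribed copulas. -/

section Model

variable {τ : ℕ} {θ₁ θ₂ θ₃ θ₄ s₁ s₂ : ℝ} (h₁ : s₁ ^ 2 = 1 - θ₁ ^ 2 - θ₃ ^ 2)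
  (h₂ : s₂ ^ 2 = 1 - θ₂ ^ 2 - θ₄ ^ 2) (f : Fin τ → PMF ℕ) (G : Fin τ → ℕ → Measure ℝ)

/-- The claims of year `t` on the canonical probability space. -/
noncomputable def canonicalClaims (θ₁ θ₂ θ₃ θ₄ s₁ s₂ : ℝ) (t : Fin τ)
    (p : ℝ × (Fin τ → ℝ × (ℕ → ℝ))) : ℕ × (ℕ → ℝ) :=
  claimsOfNoise (freqSevCoeff θ₁ θ₂) (freqSevCoeff θ₃ θ₄) (freqSevCoeff s₁ s₂) (f t) (G t)
    (p.1, p.2 t)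

theorem measurable_canonicalClaims (t : Fin τ) :
    Measurable (canonicalClaims f G θ₁ θ₂ θ₃ θ₄ s₁ s₂ t) :=
  (measurable_claimsOfNoise _ _ _ _ _).comp
    (measurable_fst.prodMk ((measurable_pi_apply t).comp measurable_snd))

include h₁ h₂ in
theorem isFactorCopulaModel_canonicalClaims :
    IsFactorCopulaModel (factorNoise τ) (θ₁ * θ₂ + θ₃ * θ₄) (θ₂ ^ 2 + θ₄ ^ 2) (θ₁ ^ 2)
      (θ₁ * θ₂) (θ₂ ^ 2) θ₁ θ₂ f G Prod.fst
      (fun t p => (canonicalClaims f G θ₁ θ₂ θ₃ θ₄ s₁ s₂ t p).1)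
      (fun t j p => (canonicalClaims f G θ₁ θ₂ θ₃ θ₄ s₁ s₂ t p).2 j) := by
  intro k n y r
  have key (p : ℝ × (Fin τ → ℝ × (ℕ → ℝ))) := forall_claimIndex_marginalValues_iff (k := k)
    (freqSevCoeff θ₁ θ₂) (freqSevCoeff θ₃ θ₄) (freqSevCoeff s₁ s₂) f G n y p
  rw [← factorLoading_mul_transpose h₁ h₂, gaussianCopula_mul_transpose, ← map_noiseVector,
    map_measureReal_apply (measurable_noiseVector k)]
  · congr 1
    ext p
    simp only [Set.mem_ofPred_eq, Set.mem_preimage, Sum.forall, Sum.elim_inl, Sum.elim_inr]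
    refine and_congr ?_ (key p).symm
    rw [← stdNormalCDF_strictMono.le_iff_le]
    exact ⟨fun H _ => (factorLoading_mulVec_inl _ _ _ p).symm ▸ H,
      fun H => factorLoading_mulVec_inl _ _ _ p ▸ H ()⟩
  · exact measurableSet_forall_stdNormalCDF_mulVec_le _ _

include h₁ h₂ in
theorem isClaimCopulaModel_canonicalClaims :
    IsClaimCopulaModel (factorNoise τ) (θ₁ * θ₂ + θ₃ * θ₄) (θ₂ ^ 2 + θ₄ ^ 2) (θ₁ ^ 2)
      (θ₁ * θ₂) (θ₂ ^ 2) f G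
      (fun t p => (canonicalClaims f G θ₁ θ₂ θ₃ θ₄ s₁ s₂ t p).1)
      (fun t j p => (canonicalClaims f G θ₁ θ₂ θ₃ θ₄ s₁ s₂ t p).2 j) := by
  intro k n y
  have key (p : ℝ × (Fin τ → ℝ × (ℕ → ℝ))) := forall_claimIndex_marginalValues_iff (k := k)
    (freqSevCoeff θ₁ θ₂) (freqSevCoeff θ₃ θ₄) (freqSevCoeff s₁ s₂) f G n y p
  rw [← claimLoading_mul_transpose h₁ h₂, gaussianCopula_mul_transpose, ← map_noiseVector,
    map_measureReal_apply (measurable_noiseVector k)]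
  · congr 1
    ext p
    exact (key p).symm
  · exact measurableSet_forall_stdNormalCDF_mulVec_le _ _

end Model

/-! ### Levels attained by continuous distribution functions. -/

section ContinuousCDF

theorem continuous_cdf_of_absolutelyContinuous {G : Measure ℝ} [IsProbabilityMeasure G]
    (h : G.AbsolutelyContinuous volume) : Continuous (cdf G) := by
  refine continuous_iff_continuousAt.2 fun x => ?_
  rw [(monotone_cdf G).continuousAt_iff_leftLim_eq_rightLim, StieltjesFunction.rightLim_eq]
  refine le_antisymm ((monotone_cdf G).leftLim_le le_rfl) ?_
  have h0 : G {x} = 0 := h (measure_singleton x)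
  rw [← measure_cdf G, StieltjesFunction.measure_singleton, ENNReal.ofReal_eq_zero] at h0
  linarith

theorem exists_cdf_eq_of_absolutelyContinuous {G : Measure ℝ} [IsProbabilityMeasure G]
    (h : G.AbsolutelyContinuous volume) {u : ℝ} (h0 : 0 < u) (h1 : u < 1) : ∃ c, cdf G c = u := by
  refine mem_range_of_exists_le_of_exists_ge (continuous_cdf_of_absolutelyContinuous h) ?_ ?_
  · exact (((tendsto_cdf_atBot G).eventually (gt_mem_nhds h0)).exists).imp fun _ h => le_of_lt h
  · exact (((tendsto_cdf_atTop G).eventually (lt_mem_nhds h1)).exists).imp fun _ h => le_of_lt h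

theorem exists_stdNormalCDF_le_iff {u : ℝ} (h0 : 0 < u) (h1 : u < 1) :
    ∃ c, stdNormalCDF c = u ∧ ∀ x, stdNormalCDF x ≤ u ↔ x ≤ c := by
  obtain ⟨c, hc⟩ := exists_cdf_eq_of_absolutelyContinuous
    (gaussianReal_absolutelyContinuous 0 one_ne_zero) h0 h1
  have hc : stdNormalCDF c = u := hc
  exact ⟨c, hc, fun x => by rw [← hc, stdNormalCDF_strictMono.le_iff_le]⟩

theorem measureReal_stdNormalCDF_le {u : ℝ} (h0 : 0 ≤ u) (h1 : u ≤ 1) :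
    (gaussianReal 0 1).real {x | stdNormalCDF x ≤ u} = u := by
  rcases h0.eq_or_lt with rfl | h0
  · simp [not_le.2 (stdNormalCDF_pos _)]
  rcases h1.eq_or_lt with rfl | h1
  · simp [(stdNormalCDF_lt_one _).le]
  obtain ⟨c, hc, hle⟩ := exists_stdNormalCDF_le_iff h0 h1
  simp_rw [hle]
  rw [← hc, stdNormalCDF_eq]
  rfl

theorem map_quantileTransform (G : Measure ℝ) [IsProbabilityMeasure G] :
    (gaussianReal 0 1).map (quantileTransform G) = G := by
  have := Measure.isProbabilityMeasure_map (μ := gaussianReal 0 1)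
    (measurable_quantileTransform G).aemeasurable
  refine Measure.eq_of_cdf _ _ ?_
  ext y
  rw [cdf_eq_real, map_measureReal_apply (measurable_quantileTransform G) measurableSet_Iic,
    ← measureReal_stdNormalCDF_le (cdf_nonneg G y) (cdf_le_one G y)]
  congr 1
  ext x
  exact quantileTransform_le_iff G x y

end ContinuousCDF

/-! ### Absolute continuity of severities given the effect. -/

section AbsolutelyContinuous

/-- A nondegenerate affine image of the standard normal law is absolutely continuous with respect to
that law, which the quantile transform carries to `G`. -/
theorem map_quantileTransform_affine_absolutelyContinuous {G : Measure ℝ}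
    [IsProbabilityMeasure G] (hG : G.AbsolutelyContinuous volume) (c : ℝ) {s : ℝ} (hs : s ≠ 0) :
    ((gaussianReal 0 1).map fun x => quantileTransform G (c + s * x)).AbsolutelyContinuous
      volume := by
  have haff : ((gaussianReal 0 1).map fun x => c + s * x).AbsolutelyContinuous
      (gaussianReal 0 1) := by
    have : (fun x : ℝ => c + s * x) = (fun x => c + x) ∘ fun x => s * x := rfl
    rw [this, ← Measure.map_map (by fun_prop) (by fun_prop), gaussianReal_map_const_mul,
      gaussianReal_map_const_add]
    refine (gaussianReal_absolutelyContinuous _ ?_).trans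
      (gaussianReal_absolutelyContinuous' 0 one_ne_zero)
    simpa [← NNReal.coe_ne_zero] using hs
  have h := haff.map (measurable_quantileTransform G)
  rw [map_quantileTransform, Measure.map_map (measurable_quantileTransform G) (by fun_prop)] at h
  exact h.trans hG

theorem map_severities_absolutelyContinuous {G : ℕ → Measure ℝ} [∀ j, IsProbabilityMeasure (G j)]
    (hG : ∀ j, (G j).AbsolutelyContinuous volume) (c s : ℕ → ℝ) (hs : ∀ j, s j ≠ 0) (n : ℕ) :
    ((Measure.infinitePi fun _ : ℕ => gaussianReal 0 1).map fun e (j : Fin n) =>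
      quantileTransform (G j) (c (j + 1) + s (j + 1) * e (j + 1))).AbsolutelyContinuous volume := by
  have hm (j : Fin n) :
      Measurable fun x => quantileTransform (G j) (c (j + 1) + s (j + 1) * x) :=
    (measurable_quantileTransform _).comp (by fun_prop)
  have hinj : Function.Injective fun j : Fin n => (j : ℕ) + 1 := fun i j h => by
    simpa [Fin.ext_iff] using h
  have hind := ((iIndepFun_infinitePi (P := fun _ : ℕ => gaussianReal 0 1)
    (X := fun _ x => x) fun _ => measurable_id).precomp hinj).comp _ hm
  have hm' (j : Fin n) := (hm j).comp (measurable_pi_apply (X := fun _ => ℝ) ((j : ℕ) + 1))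
  have := (iIndepFun_iff_map_fun_eq_pi_map fun j => (hm' j).aemeasurable).1 hind
  refine Measure.AbsolutelyContinuous.trans (Measure.absolutelyContinuous_of_eq this) ?_
  have hprob (j : Fin n) := Measure.isProbabilityMeasure_map
    (μ := Measure.infinitePi fun _ : ℕ => gaussianReal 0 1) (hm' j).aemeasurable
  refine pi_absolutelyContinuous _ _ fun j => ?_
  rw [← Measure.map_map (hm j) (measurable_pi_apply _), Measure.infinitePi_map_eval]
  exact map_quantileTransform_affine_absolutelyContinuous (hG j) _ (hs _)

/-- With the effect `r` and the year factor `m` both frozen, the severities are independent and only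
their errors remain random; null sets are tested section by section. -/
theorem map_effect_severities_absolutelyContinuous {a b s : ℕ → ℝ} (hs : ∀ j, s j ≠ 0)
    (f : PMF ℕ) {G : ℕ → Measure ℝ} [∀ j, IsProbabilityMeasure (G j)]
    (hG : ∀ j, (G j).AbsolutelyContinuous volume) (n : ℕ) :
    (((gaussianReal 0 1).prod yearNoise).map fun p =>
      (p.1, fun j : Fin n => (claimsOfNoise a b s f G p).2 j)).AbsolutelyContinuous
        ((gaussianReal 0 1).prod volume) := by
  have hc := measurable_claimsOfNoise a b s f G
  have hm : Measurable fun p : ℝ × ℝ × (ℕ → ℝ) =>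
      (p.1, fun j : Fin n => (claimsOfNoise a b s f G p).2 j) :=
    measurable_fst.prodMk (measurable_pi_lambda _ fun j =>
      (measurable_pi_apply _).comp (measurable_snd.comp hc))
  refine Measure.AbsolutelyContinuous.mk fun B hB h0 => ?_
  rw [Measure.measure_prod_null hB] at h0
  rw [Measure.map_apply hm hB, Measure.measure_prod_null (hm hB)]
  filter_upwards [h0] with r hr
  have hmr : MeasurableSet (Prod.mk r ⁻¹' ((fun p : ℝ × ℝ × (ℕ → ℝ) =>
      (p.1, fun j : Fin n => (claimsOfNoise a b s f G p).2 j)) ⁻¹' B)) :=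
    measurable_prodMk_left (hm hB)
  rw [Pi.zero_apply, yearNoise, Measure.measure_prod_null hmr]
  refine Filter.Eventually.of_forall fun m => ?_
  have hac := map_severities_absolutelyContinuous hG (fun i => a i * r + b i * m) s hs n hr
  rwa [Measure.map_apply _ (measurable_prodMk_left hB)] at hac
  exact measurable_pi_lambda _ fun j => (measurable_quantileTransform _).comp (by fun_prop)

end AbsolutelyContinuous

/-! ### Reference measures for observations of fixed and random length. -/

section ReferenceMeasures

/-- Covers both kinds of observation: `d n = n` with `e = Sigma.mk` for random length, constant `d`
with `e = Prod.mk` for fixed length. The event is contained in the countable union over `n` of the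
events with `N` replaced by `n`, so the dependence between `N` and the severities plays no role. -/
theorem absolutelyContinuous_prod_sum {Ω E : Type*} [MeasurableSpace Ω] [MeasurableSpace E]
    {P : Measure Ω} [IsProbabilityMeasure P] {R : Ω → ℝ} (hR : Measurable R)
    {N : Ω → ℕ} {Y : ℕ → Ω → ℝ} (hY : ∀ j, Measurable (Y j)) {d : ℕ → ℕ}
    {e : (n : ℕ) → (Fin (d n) → ℝ) → E} (he : ∀ n, Measurable (e n))
    (hZ : Measurable fun ω => e (N ω) fun j => Y j ω)
    (hac : ∀ n, (P.map fun ω => (R ω, fun j : Fin n => Y j ω)).AbsolutelyContinuous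
      ((P.map R).prod volume)) :
    (P.map fun ω => (R ω, e (N ω) fun j => Y j ω)).AbsolutelyContinuous
      ((P.map R).prod (Measure.sum fun n => (volume : Measure (Fin (d n) → ℝ)).map (e n))) := by
  refine Measure.AbsolutelyContinuous.mk fun B hB h0 => ?_
  rw [Measure.map_apply (hR.prodMk hZ) hB]
  rw [Measure.measure_prod_null hB] at h0
  have hsub : (fun ω => (R ω, e (N ω) fun j => Y j ω)) ⁻¹' B ⊆
      ⋃ n, (fun ω => (R ω, fun j : Fin (d n) => Y j ω)) ⁻¹' (Prod.map id (e n) ⁻¹' B) :=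
    fun ω hω => Set.mem_iUnion.2 ⟨N ω, hω⟩
  refine measure_mono_null hsub (measure_iUnion_null fun n => ?_)
  have hBn : MeasurableSet (Prod.map id (e n) ⁻¹' B) := (measurable_id.prodMap (he n)) hB
  have hn : ((P.map R).prod volume) (Prod.map id (e n) ⁻¹' B) = 0 := by
    rw [Measure.measure_prod_null hBn]
    filter_upwards [h0] with r hr
    rw [Pi.zero_apply, Measure.sum_apply _ (measurable_prodMk_left hB), ENNReal.tsum_eq_zero] at hr
    have := hr n
    rwa [Measure.map_apply (he n) (measurable_prodMk_left hB)] at this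
  have := hac (d n) hn
  rwa [Measure.map_apply (hR.prodMk (measurable_pi_lambda _ fun j : Fin (d n) => hY j)) hBn] at this

theorem measurableSet_sigma_iff {ι : Type*} {E : ι → Type*} [∀ i, MeasurableSpace (E i)]
    {B : Set (Σ i, E i)} : MeasurableSet B ↔ ∀ i, MeasurableSet (Sigma.mk i ⁻¹' B) :=
  MeasurableSpace.measurableSet_iInf

theorem measurable_sigmaMk {ι : Type*} {E : ι → Type*} [∀ i, MeasurableSpace (E i)] (i : ι) :
    Measurable (Sigma.mk i : E i → Σ i, E i) := fun _ hB => measurableSet_sigma_iff.1 hB i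

instance : SigmaFinite yearObsMeasure := by
  let D (q : ℕ × ℕ) : Set (Σ n : ℕ, (Fin n → ℝ)) := {z | z.1 = q.1 ∧ ‖z.2‖ ≤ q.2}
  have hD (q : ℕ × ℕ) : MeasurableSet (D q) := measurableSet_sigma_iff.2 fun n =>
    (MeasurableSet.const (n = q.1)).inter (measurableSet_le measurable_norm measurable_const)
  refine Measure.sigmaFinite_of_countable (S := Set.range D) (Set.countable_range D) ?_ ?_
  · rintro _ ⟨q, rfl⟩
    rw [yearObsMeasure, Measure.sum_apply _ (hD q), tsum_eq_single q.1]
    · rw [Measure.map_apply (measurable_sigmaMk _) (hD q)]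
      refine (measure_mono (t := Metric.closedBall 0 (q.2 : ℝ)) fun x hx => ?_).trans_lt
        measure_closedBall_lt_top
      simpa using hx.2
    · intro n hn
      rw [Measure.map_apply (measurable_sigmaMk _) (hD q)]
      refine measure_mono_null (fun x hx => hn hx.1) measure_empty
  · refine Set.eq_univ_of_forall fun z => ?_
    obtain ⟨m, hm⟩ := exists_nat_ge ‖z.2‖
    exact ⟨_, ⟨(z.1, m), rfl⟩, rfl, hm⟩

theorem yearVecMeasure_eq_sum (k : ℕ) :
    yearVecMeasure k = Measure.sum fun n => (volume : Measure (Fin k → ℝ)).map (Prod.mk n) := by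
  simp_rw [yearVecMeasure, Measure.count, Measure.prod_sum_left, Measure.dirac_prod]

instance (k : ℕ) : SigmaFinite (yearVecMeasure k) := by
  unfold yearVecMeasure
  infer_instance

/-- The observation of random length, as a function of the frequency and all severities. -/
def obsOfClaims (v : ℕ × (ℕ → ℝ)) : Σ n : ℕ, (Fin n → ℝ) := ⟨v.1, fun j => v.2 j⟩

/-- The frequency and the first `k` severities, as a function of the frequency and all
severities. -/
def vecOfClaims (k : ℕ) (v : ℕ × (ℕ → ℝ)) : ℕ × (Fin k → ℝ) := (v.1, fun j => v.2 j)

theorem measurable_obsOfClaims : Measurable obsOfClaims :=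
  measurable_from_prod_countable_right fun n =>
    (measurable_sigmaMk n).comp (measurable_pi_lambda _ fun j => measurable_pi_apply (j : ℕ))

theorem measurable_vecOfClaims (k : ℕ) : Measurable (vecOfClaims k) := by
  unfold vecOfClaims
  fun_prop

end ReferenceMeasures

/-! ### The copula model determines the joint law. -/

section Law

variable {Ω : Type*} [MeasurableSpace Ω] {P : Measure Ω} {τ : ℕ}

/-- The random effect, the frequencies and the severities as a single family of real variables:
`⟨t, 0⟩` is the frequency of year `t`, and `⟨t, j + 1⟩` its severity with number `j`. -/
def jointVector (R : Ω → ℝ) (N : Fin τ → Ω → ℕ) (Y : Fin τ → ℕ → Ω → ℝ) (ω : Ω) :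
    Option (Σ _ : Fin τ, ℕ) → ℝ
  | none => R ω
  | some ⟨t, 0⟩ => N t ω
  | some ⟨t, j + 1⟩ => Y t j ω

theorem measurable_jointVector {R : Ω → ℝ} (hR : Measurable R) {N : Fin τ → Ω → ℕ}
    (hN : ∀ t, Measurable (N t)) {Y : Fin τ → ℕ → Ω → ℝ} (hY : ∀ t j, Measurable (Y t j)) :
    Measurable (jointVector R N Y) := by
  refine measurable_pi_lambda _ fun i => ?_
  rcases i with _ | ⟨t, _ | j⟩
  · exact hR
  · exact (measurable_from_nat (f := ((↑) : ℕ → ℝ))).comp (hN t)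
  · exact hY t j

/-- The indices of the random effect, the frequencies and the first `k t` severities. -/
def jointIndices (k : Fin τ → ℕ) : Finset (Option (Σ _ : Fin τ, ℕ)) :=
  Finset.insertNone (Finset.univ.sigma fun t => Finset.range (k t + 1))

theorem forall_mem_jointIndices (k : Fin τ → ℕ) (p : Option (Σ _ : Fin τ, ℕ) → Prop) :
    (∀ i ∈ jointIndices k, p i) ↔
      p none ∧ ∀ t, p (some ⟨t, 0⟩) ∧ ∀ j : Fin (k t), p (some ⟨t, j + 1⟩) := by
  constructor
  · refine fun h => ⟨h _ (by simp [jointIndices]), fun t => ⟨h _ ?_, fun j => h _ ?_⟩⟩ <;>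
      simp [jointIndices]
  · rintro ⟨h0, h⟩ (_ | ⟨t, _ | j⟩) hi
    · exact h0
    · exact (h t).1
    · have hj : j < k t := by simpa [jointIndices] using hi
      exact (h t).2 ⟨j, hj⟩

theorem subset_jointIndices (s : Finset (Option (Σ _ : Fin τ, ℕ))) :
    ∃ k, s ⊆ jointIndices k := by
  refine ⟨fun _ => s.eraseNone.sup fun q => q.2, fun i hi => ?_⟩
  rcases i with _ | q
  · simp [jointIndices]
  · have : q.2 ≤ s.eraseNone.sup fun q => q.2 :=
      Finset.le_sup (f := fun q : Σ _ : Fin τ, ℕ => q.2) (Finset.mem_eraseNone.2 hi)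
    simpa [jointIndices, Nat.lt_succ_iff] using this

/-- The right side involves only the model parameters, so two models agree on all these events. Real
bounds on frequencies reduce to integer ones by rounding down, and a negative bound is never met. -/
theorem IsFactorCopulaModel.measureReal_jointVector_le {ρ₁ ρ₂ ρ₃ ρ₄ ρ₅ θ₁ θ₂ : ℝ}
    {f : Fin τ → PMF ℕ} {G : Fin τ → ℕ → Measure ℝ} {R : Ω → ℝ} {N : Fin τ → Ω → ℕ}
    {Y : Fin τ → ℕ → Ω → ℝ} (h : IsFactorCopulaModel P ρ₁ ρ₂ ρ₃ ρ₄ ρ₅ θ₁ θ₂ f G R N Y)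
    (k : Fin τ → ℕ) (c : Option (Σ _ : Fin τ, ℕ) → ℝ) :
    P.real {ω | ∀ i ∈ jointIndices k, jointVector R N Y ω i ≤ c i} =
      open Classical in if ∃ t, c (some ⟨t, 0⟩) < 0 then 0 else
        gaussianCopula (factorCorr ρ₁ ρ₂ ρ₃ ρ₄ ρ₅ θ₁ θ₂ k)
          (Sum.elim (fun _ => stdNormalCDF (c none))
            (marginalValues f G k (fun t => ⌊c (some ⟨t, 0⟩)⌋₊)
              fun t j => c (some ⟨t, j + 1⟩))) := by
  simp only [forall_mem_jointIndices]
  split_ifs with hc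
  · obtain ⟨t, ht⟩ := hc
    convert measureReal_empty (μ := P)
    refine Set.eq_empty_of_forall_notMem fun ω hω => ?_
    have : (N t ω : ℝ) ≤ c (some ⟨t, 0⟩) := (hω.2 t).1
    have : (0 : ℝ) ≤ N t ω := Nat.cast_nonneg _
    linarith
  · push Not at hc
    rw [← h]
    congr 1
    ext ω
    refine and_congr Iff.rfl (forall_congr' fun t => and_congr ?_ Iff.rfl)
    exact (Nat.le_floor_iff (hc t)).symm

theorem IsFactorCopulaModel.map_eq [IsProbabilityMeasure P] {Ω' : Type*} [MeasurableSpace Ω']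
    {P' : Measure Ω'} [IsProbabilityMeasure P'] {ρ₁ ρ₂ ρ₃ ρ₄ ρ₅ θ₁ θ₂ : ℝ} {f : Fin τ → PMF ℕ}
    {G : Fin τ → ℕ → Measure ℝ} {R : Ω → ℝ} (hR : Measurable R) {N : Fin τ → Ω → ℕ}
    (hN : ∀ t, Measurable (N t)) {Y : Fin τ → ℕ → Ω → ℝ} (hY : ∀ t j, Measurable (Y t j))
    {R' : Ω' → ℝ} (hR' : Measurable R') {N' : Fin τ → Ω' → ℕ} (hN' : ∀ t, Measurable (N' t))
    {Y' : Fin τ → ℕ → Ω' → ℝ} (hY' : ∀ t j, Measurable (Y' t j))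
    (h : IsFactorCopulaModel P ρ₁ ρ₂ ρ₃ ρ₄ ρ₅ θ₁ θ₂ f G R N Y)
    (h' : IsFactorCopulaModel P' ρ₁ ρ₂ ρ₃ ρ₄ ρ₅ θ₁ θ₂ f G R' N' Y') :
    P.map (fun ω => (R ω, fun t => (N t ω, fun j => Y t j ω))) =
      P'.map fun ω => (R' ω, fun t => (N' t ω, fun j => Y' t j ω)) := by
  have hm := measurable_jointVector hR hN hY
  have hm' := measurable_jointVector hR' hN' hY'
  have := Measure.isProbabilityMeasure_map (μ := P) hm.aemeasurable
  have := Measure.isProbabilityMeasure_map (μ := P') hm'.aemeasurable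
  have heq : P.map (jointVector R N Y) = P'.map (jointVector R' N' Y') := by
    refine measure_pi_real_ext jointIndices subset_jointIndices fun k c => ?_
    have hs : MeasurableSet {x : Option (Σ _ : Fin τ, ℕ) → ℝ | ∀ i ∈ jointIndices k, x i ≤ c i} := by
      have : {x : Option (Σ _ : Fin τ, ℕ) → ℝ | ∀ i ∈ jointIndices k, x i ≤ c i} =
          ⋂ i ∈ jointIndices k, {x | x i ≤ c i} := by
        ext
        simp
      rw [this]
      exact Finset.measurableSet_biInter _ fun i _ =>
        measurableSet_le (measurable_pi_apply i) measurable_const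
    rw [← measureReal_eq_measureReal_iff, map_measureReal_apply hm hs,
      map_measureReal_apply hm' hs]
    exact (h.measureReal_jointVector_le k c).trans (h'.measureReal_jointVector_le k c).symm
  -- The floor undoes the cast of the frequencies to reals.
  let ψ (x : Option (Σ _ : Fin τ, ℕ) → ℝ) : ℝ × (Fin τ → ℕ × (ℕ → ℝ)) :=
    (x none, fun t => (⌊x (some ⟨t, 0⟩)⌋₊, fun j => x (some ⟨t, j + 1⟩)))
  have hψ : Measurable ψ := by
    refine (measurable_pi_apply _).prodMk (measurable_pi_lambda _ fun t => ?_)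
    exact (Nat.measurable_floor.comp (measurable_pi_apply _)).prodMk
      (measurable_pi_lambda _ fun j => measurable_pi_apply _)
  have e := congrArg (Measure.map ψ) heq
  rw [Measure.map_map hψ hm, Measure.map_map hψ hm'] at e
  simpa [ψ, Function.comp_def, jointVector] using e

end Law

/-! ### Independence of the claims from the effect. -/

section Independence

variable {Ω : Type*} [MeasurableSpace Ω] {P : Measure Ω} {R : Ω → ℝ}

theorem indepFun_of_map_eq [IsProbabilityMeasure P] {V S E : Type*} [MeasurableSpace V]
    [MeasurableSpace S] [MeasurableSpace E] {γ : Measure ℝ} {μ : Measure S} [IsProbabilityMeasure γ]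
    [IsProbabilityMeasure μ] (hR : Measurable R) {Z : Ω → V} (hZ : Measurable Z)
    {z : ℝ × S → V} (hz : Measurable z)
    (hlaw : P.map (fun ω => (R ω, Z ω)) = (γ.prod μ).map fun p => (p.1, z p)) {φ : V → E}
    (hφ : Measurable φ) {g : S → E} (hg : Measurable g) (hzg : ∀ p, φ (z p) = g p.2) :
    IndepFun (fun ω => φ (Z ω)) R P := by
  have e : P.map (fun ω => (R ω, φ (Z ω))) = γ.prod (μ.map g) := by
    have := congrArg (Measure.map (Prod.map id φ)) hlaw
    rw [Measure.map_map (by fun_prop) (by fun_prop),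
      Measure.map_map (by fun_prop) (by fun_prop)] at this
    have h2 := Measure.map_prod_map γ μ measurable_id hg
    rw [Measure.map_id] at h2
    have hpm : Prod.map id g = fun p : ℝ × S => (p.1, g p.2) := rfl
    rw [h2, hpm]
    simpa [Function.comp_def, hzg] using this
  have := Measure.isProbabilityMeasure_map (μ := μ) hg.aemeasurable
  have hm : Measurable fun ω => φ (Z ω) := hφ.comp hZ
  have e1 : P.map R = γ := by
    rw [← Measure.fst_map_prodMk hm, e, Measure.fst_prod]
  have e2 : P.map (fun ω => φ (Z ω)) = μ.map g := by
    rw [← Measure.snd_map_prodMk hR, e, Measure.snd_prod]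
  refine IndepFun.symm ((indepFun_iff_map_prod_eq_prod_map_map hR.aemeasurable hm.aemeasurable).2 ?_)
  rw [e, e1, e2]

/-- The section measure is the conditional probability of `B` given `R = r`; under independence it
must equal the unconditional one. -/
theorem ae_measure_section_eq_of_indepFun {V S E : Type*} [MeasurableSpace V] [MeasurableSpace S]
    [MeasurableSpace E] {γ : Measure ℝ} {μ : Measure S} [IsProbabilityMeasure γ]
    [IsProbabilityMeasure μ] (hR : Measurable R) {Z : Ω → V} (hZ : Measurable Z)
    {z : ℝ × S → V} (hz : Measurable z)
    (hlaw : P.map (fun ω => (R ω, Z ω)) = (γ.prod μ).map fun p => (p.1, z p)) {φ : V → E}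
    (hφ : Measurable φ) (hind : IndepFun (fun ω => φ (Z ω)) R P) {B : Set E}
    (hB : MeasurableSet B) :
    ∃ p, (fun r => μ {s | φ (z (r, s)) ∈ B}) =ᵐ[γ] fun _ => p := by
  have hm : Measurable fun ω => φ (Z ω) := hφ.comp hZ
  have e1 : P.map R = γ := by
    rw [← Measure.fst_map_prodMk hZ, hlaw, Measure.fst_map_prodMk hz, ← Measure.fst,
      Measure.fst_prod]
  refine ⟨P ((fun ω => φ (Z ω)) ⁻¹' B), ?_⟩
  have hφz : Measurable fun p => φ (z p) := hφ.comp hz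
  refine ae_eq_of_forall_setLIntegral_eq_of_sigmaFinite
    (measurable_measure_prodMk_left (hφz hB)) measurable_const fun A hA _ => ?_
  have hAB : MeasurableSet (A ×ˢ (φ ⁻¹' B)) := hA.prod (hφ hB)
  have h := congrArg (fun m => m (A ×ˢ (φ ⁻¹' B))) hlaw
  rw [Measure.map_apply (hR.prodMk hZ) hAB, Measure.map_apply (measurable_fst.prodMk hz) hAB,
    Measure.prod_apply ((measurable_fst.prodMk hz) hAB)] at h
  have h3 := (indepFun_iff_measure_inter_preimage_eq_mul.1 hind) B A hB hA
  rw [setLIntegral_const, ← e1, Measure.map_apply hR hA, ← h3, e1, ← lintegral_indicator hA]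
  rw [Set.inter_comm]
  refine Eq.trans ?_ h.symm
  refine lintegral_congr fun r => ?_
  by_cases hr : r ∈ A
  · rw [Set.indicator_of_mem hr]
    congr 1
    ext s
    simp [hr]
  · rw [Set.indicator_of_notMem hr]
    refine (measure_mono_null (fun s hs => hr hs.1) measure_empty).symm

theorem yearNoise_pos_of_lt (b s : ℝ) (hs : s ≠ 0) (i : ℕ) {u v : ℝ} (huv : u < v) :
    0 < yearNoise {x | u < b * x.1 + s * x.2 i ∧ b * x.1 + s * x.2 i < v} := by
  have h := Measure.map_prod_map (gaussianReal 0 1)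
    (Measure.infinitePi fun _ : ℕ => gaussianReal 0 1) measurable_id (measurable_pi_apply i)
  rw [Measure.map_id, Measure.infinitePi_map_eval] at h
  have hopen : IsOpen {q : ℝ × ℝ | u < b * q.1 + s * q.2 ∧ b * q.1 + s * q.2 < v} :=
    (isOpen_lt (by fun_prop) (by fun_prop)).and (isOpen_lt (by fun_prop) (by fun_prop))
  have hne : {q : ℝ × ℝ | u < b * q.1 + s * q.2 ∧ b * q.1 + s * q.2 < v}.Nonempty := by
    obtain ⟨w, hw⟩ := exists_between huv
    refine ⟨(0, w / s), ?_⟩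
    simpa [mul_div_cancel₀ _ hs] using hw
  have := hopen.measure_pos ((gaussianReal 0 1).prod (gaussianReal 0 1)) hne
  rwa [h, Measure.map_apply (by fun_prop) hopen.measurableSet] at this

/-- The two events differ by at least the open strip `D`, which has positive probability because the
error has a nonzero coefficient. -/
theorem yearNoise_normalScore_le_strictAnti {a b s : ℕ → ℝ} {i : ℕ} (hs : s i ≠ 0) (c : ℝ)
    {r₁ r₂ : ℝ} (hr : a i * r₁ < a i * r₂) :
    yearNoise {x | normalScore a b s i (r₂, x) ≤ c} <
      yearNoise {x | normalScore a b s i (r₁, x) ≤ c} := by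
  set D := {x : ℝ × (ℕ → ℝ) | c - a i * r₂ < b i * x.1 + s i * x.2 i ∧
    b i * x.1 + s i * x.2 i < c - a i * r₁}
  have hpos : 0 < yearNoise D := yearNoise_pos_of_lt (b i) (s i) hs i (by linarith)
  have hm (r : ℝ) : MeasurableSet {x | normalScore a b s i (r, x) ≤ c} :=
    measurableSet_le ((measurable_normalScore a b s i).comp (by fun_prop)) measurable_const
  have hdisj : Disjoint {x | normalScore a b s i (r₂, x) ≤ c} D := by
    refine Set.disjoint_left.2 fun x hx hxD => ?_
    have h1 : a i * r₂ + b i * x.1 + s i * x.2 i ≤ c := hx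
    have := hxD.1
    linarith
  have hsub : {x | normalScore a b s i (r₂, x) ≤ c} ∪ D ⊆
      {x | normalScore a b s i (r₁, x) ≤ c} := by
    rintro x (hx | hx)
    · have h1 : a i * r₂ + b i * x.1 + s i * x.2 i ≤ c := hx
      change a i * r₁ + b i * x.1 + s i * x.2 i ≤ c
      linarith
    · change a i * r₁ + b i * x.1 + s i * x.2 i ≤ c
      have := hx.2
      linarith
  calc _ < yearNoise {x | normalScore a b s i (r₂, x) ≤ c} + yearNoise D :=
        ENNReal.lt_add_right (measure_ne_top _ _) hpos.ne'
    _ = yearNoise ({x | normalScore a b s i (r₂, x) ≤ c} ∪ D) :=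
        (measure_union' hdisj (hm r₂)).symm
    _ ≤ _ := measure_mono hsub

/-- A set of full normal measure is dense, so it contains points `r₁ < 0 < r₂` where the
probabilities coincide, against strict monotonicity. -/
theorem coeff_eq_zero_of_ae_eq_const {a b s : ℕ → ℝ} {i : ℕ} (hs : s i ≠ 0) {c : ℝ} {p : ℝ≥0∞}
    (h : (fun r => yearNoise {x | normalScore a b s i (r, x) ≤ c}) =ᵐ[gaussianReal 0 1]
      fun _ => p) : a i = 0 := by
  by_contra ha
  have hd := Measure.dense_of_ae h
  obtain ⟨r₁, hr₁, h₁⟩ := hd.exists_mem_open isOpen_Iio (Set.nonempty_Iio (a := (0 : ℝ)))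
  obtain ⟨r₂, hr₂, h₂⟩ := hd.exists_mem_open isOpen_Ioi (Set.nonempty_Ioi (a := (0 : ℝ)))
  have hlt : r₁ < r₂ := lt_trans h₁ h₂
  have hr₁ : yearNoise {x | normalScore a b s i (r₁, x) ≤ c} = p := hr₁
  have hr₂ : yearNoise {x | normalScore a b s i (r₂, x) ≤ c} = p := hr₂
  rcases lt_or_gt_of_ne ha with ha | ha
  · have := yearNoise_normalScore_le_strictAnti (b := b) hs c (mul_lt_mul_of_neg_left hlt ha)
    rw [hr₁, hr₂] at this
    exact lt_irrefl _ this
  · have := yearNoise_normalScore_le_strictAnti (b := b) hs c (mul_lt_mul_of_pos_left hlt ha)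
    rw [hr₁, hr₂] at this
    exact lt_irrefl _ this

variable [IsProbabilityMeasure P] {a b s : ℕ → ℝ} {f : PMF ℕ} {G : ℕ → Measure ℝ}
  {V : Ω → ℕ × (ℕ → ℝ)}

theorem indepFun_frequency_iff (hs : s 0 ≠ 0) (hf : ∀ n, f n ≠ 1) (hR : Measurable R)
    (hV : Measurable V) (hlaw : P.map (fun ω => (R ω, V ω)) =
      ((gaussianReal 0 1).prod yearNoise).map fun p => (p.1, claimsOfNoise a b s f G p)) :
    IndepFun (fun ω => (V ω).1) R P ↔ a 0 = 0 := by
  have hc := measurable_claimsOfNoise a b s f G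
  constructor
  · intro hind
    -- The smallest atom `n` works: the distribution function there equals `f n`, which is positive
    -- and, by nondegeneracy, below one.
    obtain ⟨n, h0, h1⟩ : ∃ n, 0 < f.toMeasure.real (Set.Iic n) ∧
        f.toMeasure.real (Set.Iic n) < 1 := by
      have hne : ∃ n, f n ≠ 0 := f.support_nonempty
      classical
      let n := Nat.find hne
      have hn : f.toMeasure (Set.Iic n) = f n := by
        rw [← f.toMeasure_apply_singleton n (measurableSet_singleton n)]
        refine (f.toMeasure_apply_eq_of_inter_support_eq measurableSet_Iic
          (measurableSet_singleton n) ?_)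
        ext m
        simp only [Set.mem_inter_iff, Set.mem_Iic, Set.mem_singleton_iff, PMF.mem_support_iff]
        exact and_congr_left fun hm => ⟨fun h => le_antisymm h (Nat.find_min' hne hm), fun h => h.le⟩
      refine ⟨n, ?_, ?_⟩
      · rw [measureReal_def, hn]
        exact ENNReal.toReal_pos (Nat.find_spec hne) (f.apply_ne_top n)
      · rw [measureReal_def, hn, ← ENNReal.toReal_one]
        exact (ENNReal.toReal_lt_toReal (f.apply_ne_top n) ENNReal.one_ne_top).2
          (lt_of_le_of_ne (f.coe_le_one n) (hf n))
    obtain ⟨c, -, hle⟩ := exists_stdNormalCDF_le_iff h0 h1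
    obtain ⟨p, hp⟩ := ae_measure_section_eq_of_indepFun hR hV hc hlaw measurable_fst hind
      (measurableSet_Iic (a := n))
    simp only [claimsOfNoise, Set.mem_Iic, natQuantileTransform_le_iff, hle] at hp
    exact coeff_eq_zero_of_ae_eq_const hs hp
  · intro ha
    refine indepFun_of_map_eq hR hV hc hlaw measurable_fst
      (g := fun x => (claimsOfNoise a b s f G (0, x)).1)
      (measurable_fst.comp (hc.comp measurable_prodMk_left)) fun p => ?_
    simp [claimsOfNoise, normalScore, ha]

theorem indepFun_severities_iff [∀ j, IsProbabilityMeasure (G j)]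
    (hG : ∀ j, (G j).AbsolutelyContinuous volume) {α : ℝ} (ha : ∀ j, a (j + 1) = α)
    (hs : ∀ j, s j ≠ 0) (hR : Measurable R)
    (hV : Measurable V) (hlaw : P.map (fun ω => (R ω, V ω)) =
      ((gaussianReal 0 1).prod yearNoise).map fun p => (p.1, claimsOfNoise a b s f G p))
    {k : ℕ} (hk : 0 < k) :
    IndepFun (fun ω (j : Fin k) => (V ω).2 j) R P ↔ α = 0 := by
  have hc := measurable_claimsOfNoise a b s f G
  have hφ : Measurable fun (v : ℕ × (ℕ → ℝ)) (j : Fin k) => v.2 j := by fun_prop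
  constructor
  · intro hind
    -- Testing the first severity at its median suffices; any level strictly between zero and one
    -- would do.
    obtain ⟨y, hy⟩ := exists_cdf_eq_of_absolutelyContinuous (hG 0) (u := 1 / 2) (by norm_num)
      (by norm_num)
    obtain ⟨c, -, hle⟩ := exists_stdNormalCDF_le_iff (u := 1 / 2) (by norm_num) (by norm_num)
    obtain ⟨p, hp⟩ := ae_measure_section_eq_of_indepFun hR hV hc hlaw hφ hind
      (B := {x | x ⟨0, hk⟩ ≤ y}) (measurableSet_le (measurable_pi_apply _) measurable_const)
    simp only [claimsOfNoise, Set.mem_ofPred_eq, quantileTransform_le_iff, hy, hle] at hp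
    rw [← ha 0]
    exact coeff_eq_zero_of_ae_eq_const (hs _) hp
  · intro hα
    refine indepFun_of_map_eq hR hV hc hlaw hφ
      -- The value `0` for the effect is arbitrary, since its coefficient vanishes.
      (g := fun x (j : Fin k) => (claimsOfNoise a b s f G (0, x)).2 j)
      (hφ.comp (hc.comp measurable_prodMk_left)) fun p => ?_
    simp [claimsOfNoise, normalScore, ha, hα]

end Independence

/-! ### Transfer from the canonical model to the given one. -/

theorem measurable_claims {Ω : Type*} [MeasurableSpace Ω] {N : Ω → ℕ} (hN : Measurable N)
    {Y : ℕ → Ω → ℝ} (hY : ∀ j, Measurable (Y j)) : Measurable fun ω => (N ω, fun j => Y j ω) :=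
  hN.prodMk (measurable_pi_lambda _ hY)

theorem map_factorNoise_eval {τ : ℕ} (t : Fin τ) :
    (factorNoise τ).map (fun p => (p.1, p.2 t)) = (gaussianReal 0 1).prod yearNoise := by
  have h := Measure.map_prod_map (gaussianReal 0 1) (Measure.pi fun _ : Fin τ => yearNoise)
    measurable_id (measurable_pi_apply t)
  rw [Measure.map_id, (measurePreserving_eval (fun _ : Fin τ => yearNoise) t).map_eq] at h
  exact h.symm

theorem theorem2 {Ω : Type*} [MeasurableSpace Ω] (P : Measure Ω) [IsProbabilityMeasure P]
    (τ : ℕ) (ρ₁ ρ₂ ρ₃ ρ₄ ρ₅ θ₁ θ₂ θ₃ θ₄ : ℝ)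
    -- the reparametrization of the correlations, and the admissible parameters
    (hρ₁ : ρ₁ = θ₁ * θ₂ + θ₃ * θ₄) (hρ₂ : ρ₂ = θ₂ ^ 2 + θ₄ ^ 2) (hρ₃ : ρ₃ = θ₁ ^ 2)
    (hρ₄ : ρ₄ = θ₁ * θ₂) (hρ₅ : ρ₅ = θ₂ ^ 2)
    (hθ₁ : θ₁ ^ 2 + θ₃ ^ 2 < 1) (hθ₂ : θ₂ ^ 2 + θ₄ ^ 2 < 1)
    -- the marginal laws: frequencies on the non-negative integers, severities with a density on
    -- the non-negative reals
    (f : Fin τ → PMF ℕ) (G : Fin τ → ℕ → Measure ℝ) (hG : ∀ t j, IsProbabilityMeasure (G t j))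
    (hGpos : ∀ t j, G t j (Set.Iio 0) = 0) (hGac : ∀ t j, (G t j).AbsolutelyContinuous volume)
    -- the random effect, the frequencies and the severities
    (R : Ω → ℝ) (hR : Measurable R) (N : Fin τ → Ω → ℕ) (hN : ∀ t, Measurable (N t))
    (Y : Fin τ → ℕ → Ω → ℝ) (hY : ∀ t j, Measurable (Y t j))
    (hmodel : IsFactorCopulaModel P ρ₁ ρ₂ ρ₃ ρ₄ ρ₅ θ₁ θ₂ f G R N Y) :
    IsClaimCopulaModel P ρ₁ ρ₂ ρ₃ ρ₄ ρ₅ f G N Y ∧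
    CondDensityFactorizes P R (fun t => yearObs (N t) (Y t)) (fun _ => yearObsMeasure) ∧
    (∀ k : Fin τ → ℕ, CondDensityFactorizes P R (fun t => yearVec (k t) (N t) (Y t))
      (fun t => yearVecMeasure (k t))) ∧
    (∀ t, (∀ n, f t n ≠ 1) → (IndepFun (N t) R P ↔ θ₁ = 0)) ∧
    (∀ t (k : ℕ), 0 < k →
      (IndepFun (fun ω (j : Fin k) => Y t j ω) R P ↔ θ₂ = 0)) := by

  subst hρ₁ hρ₂ hρ₃ hρ₄ hρ₅
  have hpos₁ : 0 < 1 - θ₁ ^ 2 - θ₃ ^ 2 := by linarith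
  have hpos₂ : 0 < 1 - θ₂ ^ 2 - θ₄ ^ 2 := by linarith
  set s₁ := √(1 - θ₁ ^ 2 - θ₃ ^ 2) with hs₁
  set s₂ := √(1 - θ₂ ^ 2 - θ₄ ^ 2) with hs₂
  have h₁ : s₁ ^ 2 = 1 - θ₁ ^ 2 - θ₃ ^ 2 := Real.sq_sqrt hpos₁.le
  have h₂ : s₂ ^ 2 = 1 - θ₂ ^ 2 - θ₄ ^ 2 := Real.sq_sqrt hpos₂.le
  have hs (i : ℕ) : freqSevCoeff s₁ s₂ i ≠ 0 := by
    unfold freqSevCoeff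
    split_ifs
    exacts [(Real.sqrt_pos.2 hpos₁).ne', (Real.sqrt_pos.2 hpos₂).ne']
  have hcan (t : Fin τ) := measurable_canonicalClaims (θ₁ := θ₁) (θ₂ := θ₂) (θ₃ := θ₃) (θ₄ := θ₄)
    (s₁ := s₁) (s₂ := s₂) f G t
  have hV (t : Fin τ) := measurable_claims (hN t) (hY t)
  have hlaw : P.map (fun ω => (R ω, fun t => (N t ω, fun j => Y t j ω))) =
      (factorNoise τ).map fun p =>
        (p.1, fun t => canonicalClaims f G θ₁ θ₂ θ₃ θ₄ s₁ s₂ t p) :=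
    hmodel.map_eq hR hN hY measurable_fst (fun t => measurable_fst.comp (hcan t))
      (fun t j => (measurable_pi_apply j).comp (measurable_snd.comp (hcan t)))
      (isFactorCopulaModel_canonicalClaims h₁ h₂ f G)
  have hVm : Measurable fun ω t => (N t ω, fun j => Y t j ω) := measurable_pi_lambda _ hV
  have hcm : Measurable fun p (t : Fin τ) => canonicalClaims f G θ₁ θ₂ θ₃ θ₄ s₁ s₂ t p :=
    measurable_pi_lambda _ hcan
  have hRlaw : P.map R = gaussianReal 0 1 := by
    rw [← Measure.fst_map_prodMk hVm, hlaw, Measure.fst_map_prodMk hcm, ← Measure.fst,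
      factorNoise, Measure.fst_prod]
  have hlaw₁ (t : Fin τ) : P.map (fun ω => (R ω, (N t ω, fun j => Y t j ω))) =
      ((gaussianReal 0 1).prod yearNoise).map fun p => (p.1, claimsOfNoise (freqSevCoeff θ₁ θ₂)
        (freqSevCoeff θ₃ θ₄) (freqSevCoeff s₁ s₂) (f t) (G t) p) := by
    have h := congrArg (Measure.map fun q : ℝ × (Fin τ → ℕ × (ℕ → ℝ)) => (q.1, q.2 t)) hlaw
    rw [Measure.map_map (by fun_prop) (hR.prodMk hVm),
      Measure.map_map (by fun_prop) (measurable_fst.prodMk hcm)] at h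
    rw [← map_factorNoise_eval t, Measure.map_map
      (measurable_fst.prodMk (measurable_claimsOfNoise _ _ _ _ _)) (by fun_prop)]
    exact h
  have hac (t : Fin τ) (n : ℕ) :
      (P.map fun ω => (R ω, fun j : Fin n => Y t j ω)).AbsolutelyContinuous
        ((P.map R).prod volume) := by
    have hpr : Measurable fun q : ℝ × ℕ × (ℕ → ℝ) => (q.1, fun j : Fin n => q.2.2 j) := by fun_prop
    have h := congrArg (Measure.map fun q : ℝ × ℕ × (ℕ → ℝ) =>
      (q.1, fun j : Fin n => q.2.2 j)) (hlaw₁ t)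
    rw [Measure.map_map hpr (hR.prodMk (hV t)), Measure.map_map hpr
      (measurable_fst.prodMk (measurable_claimsOfNoise _ _ _ _ _))] at h
    rw [hRlaw]
    exact (Measure.absolutelyContinuous_of_eq h).trans
      (map_effect_severities_absolutelyContinuous hs (f t) (hGac t) n)
  -- Factorization for an arbitrary measurable function of each year's claims; observations of
  -- random and of fixed length are two instances.
  have hfactor {E : Fin τ → Type} [∀ t, MeasurableSpace (E t)]
      (φ : (t : Fin τ) → ℕ × (ℕ → ℝ) → E t) (hφ : ∀ t, Measurable (φ t))
      (ν : (t : Fin τ) → Measure (E t)) [∀ t, SigmaFinite (ν t)]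
      (hν : ∀ t, (P.map fun ω => (R ω, φ t (N t ω, fun j => Y t j ω))).AbsolutelyContinuous
        ((P.map R).prod (ν t))) :
      CondDensityFactorizes P R (fun t ω => φ t (N t ω, fun j => Y t j ω)) ν := by
    refine condDensityFactorizes_of_map_eq (μ := fun _ => yearNoise) hR
      (fun t => (hφ t).comp (hV t)) (fun t => (hφ t).comp (measurable_claimsOfNoise
        (freqSevCoeff θ₁ θ₂) (freqSevCoeff θ₃ θ₄) (freqSevCoeff s₁ s₂) (f t) (G t))) ?_ hν
    have hΦ : Measurable fun q : ℝ × (Fin τ → ℕ × (ℕ → ℝ)) => (q.1, fun t => φ t (q.2 t)) :=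
      measurable_fst.prodMk (measurable_pi_lambda _ fun t =>
        (hφ t).comp ((measurable_pi_apply t).comp measurable_snd))
    have h := congrArg (Measure.map fun q : ℝ × (Fin τ → ℕ × (ℕ → ℝ)) =>
      (q.1, fun t => φ t (q.2 t))) hlaw
    rw [Measure.map_map hΦ (hR.prodMk hVm), Measure.map_map hΦ (measurable_fst.prodMk hcm)] at h
    rw [hRlaw]
    exact h
  refine ⟨fun k n y => ?_, ?_, fun k => ?_, fun t hf => ?_, fun t k hk => ?_⟩
  · rw [← isClaimCopulaModel_canonicalClaims h₁ h₂ f G k n y]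
    have hset : MeasurableSet {v : Fin τ → ℕ × (ℕ → ℝ) |
        ∀ t, (v t).1 ≤ n t ∧ ∀ j : Fin (k t), (v t).2 j ≤ y t j} := by
      rw [Set.ofPred_forall]
      refine MeasurableSet.iInter fun t => .inter ?_ ?_
      · change MeasurableSet {v : Fin τ → ℕ × (ℕ → ℝ) | (v t).1 ≤ n t}
        exact measurableSet_le (by fun_prop) measurable_const
      · change MeasurableSet {v : Fin τ → ℕ × (ℕ → ℝ) | ∀ j : Fin (k t), (v t).2 j ≤ y t j}
        rw [Set.ofPred_forall]
        exact MeasurableSet.iInter fun j => measurableSet_le (by fun_prop) measurable_const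
    have h := congrArg (fun m => m.snd.real {v : Fin τ → ℕ × (ℕ → ℝ) |
        ∀ t, (v t).1 ≤ n t ∧ ∀ j : Fin (k t), (v t).2 j ≤ y t j}) hlaw
    rw [Measure.snd_map_prodMk hR, Measure.snd_map_prodMk measurable_fst,
      map_measureReal_apply hVm hset, map_measureReal_apply hcm hset] at h
    exact h
  · exact hfactor (fun _ => obsOfClaims) (fun _ => measurable_obsOfClaims) _ fun t =>
      absolutelyContinuous_prod_sum hR (hY t) measurable_sigmaMk
        (measurable_obsOfClaims.comp (hV t)) (hac t)
  · refine hfactor (fun t => vecOfClaims (k t)) (fun t => measurable_vecOfClaims (k t)) _ fun t => ?_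
    rw [yearVecMeasure_eq_sum]
    exact absolutelyContinuous_prod_sum hR (hY t) (d := fun _ => k t) (e := Prod.mk)
      (fun _ => measurable_prodMk_left) ((measurable_vecOfClaims (k t)).comp (hV t))
      fun n => hac t n
  · exact indepFun_frequency_iff (hs 0) hf hR (hV t) (hlaw₁ t)
  · have (j : ℕ) := hG t j
    exact indepFun_severities_iff (hGac t) (fun _ => rfl) hs hR (hV t) (hlaw₁ t) hk
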